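/- Let $p$ be a prime number and let $M$ be a CM field that is a finite Galois extension of $\mathbb{Q}$, with $G=\mathrm{Gal}(M/\mathbb{Q})$, ring of integers $\mathcal{O}_M$ and $r=\mathrm{rk}_{\mathbb{Z}}\,\mathcal{O}_M^*$. Let $\mathbb{C}_p$ be the completion of an algebraic closure of $\mathbb{Q}_p$ and let $E_p$ be the set of embeddings of $M$ into $\mathbb{C}_p$. Let $\log_p$ be the $p$-adic logarithm on $\mathbb{C}_p^*$: the homomorphism given by $\log_p x=\sum_{n\ge 1}(-1)^{n+1}(x-1)^n/n$ for $|x-1|_p<1$ that vanishes on $p$ and on the roots of unity. For real $x$ put $x^+=\max(x,0)$. Assume Schanuel's Conjecture in the logarithmic form (if $\alpha_1,\dots,\alpha_n\in\mathbb{C}^*$ are algebraic over $\mathbb{Q}$ and $\log\alpha_1,\dots,\log\alpha_n$ are linearly independent over $\mathbb{Q}$ for any choice of the multivalued logarithm, then $\log\alpha_1,\dots,\log\alpha_n$ are algebraically independent over $\mathbb{Q}$) and the $p$-adic Schanuel Conjecture in the logarithmic form (if $\alpha_1,\dots,\alpha_n\in\mathbb{C}_p^*$ are algebraic over $\mathbb{Q}$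 and $\log_p\alpha_1,\dots,\log_p\alpha_n$ are linearly independent over $\mathbb{Q}$, then they are algebraically independent over $\mathbb{Q}$). There is a unique $c\in G$ induced by complex conjugation, i.e. such that $\overline{\tau(x)}=\tau(c(x))$ for all $x\in M$, for some embedding $\tau:M\to\mathbb{C}$. For $S\subseteq E_p$ and $\sigma\in E_p$ put $J_\sigma=\{g\in G:\sigma g\notin S\}$ and let $t=t(S,\sigma)$ be the number of right cosets $\{g,cg\}$ of $\{\mathrm{id},c\}$ in $G$ that are contained in $J_\sigma$. (1) Let $\varepsilon\in\mathcal{O}_M^*$ be a weak Minkowski unit (the elements $g\varepsilon$, $g\in G$, generate a subgroup of finite index in $\mathcal{O}_M^*$) such that $|\sigma g\varepsilon-1|_p<1$ for all $\sigma\in E_p$ and $g\in G$. Then for every $S\subseteq E_p$ and every $\sigma\in E_p$, $$\mathrm{rk}\,\bigl(\log_p(\sigma' g\varepsilon)\bigr)_{\sigma'\in S,\ g\in G}=r-(t(S,\sigma)-1)^+ .$$ (2) Let $\Gamma$ be a non-empty set of primes of $\mathcal{O}_M$ above $p$. For $\mathfrak{p}\in\Gamma$ let $\mathcal{O}_{\mathfrak{p},1}^*=1+\pi\mathcal{O}_{\mathfrak{p}}$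 be the group of principal units of the completion $M_{\mathfrak{p}}$, a $\mathbb{Z}_p$-module by exponentiation. Let $\Delta_\Gamma$ be the diagonal map from $\mathcal{O}_M^*$ to $\prod_{\mathfrak{p}\in\Gamma}\mathcal{O}_{\mathfrak{p}}^*$, let $Y=\Delta_\Gamma^{-1}\bigl(\prod_{\mathfrak{p}\in\Gamma}\mathcal{O}_{\mathfrak{p},1}^*\bigr)$, and let $\overline{\Delta_\Gamma(Y)}$ be the closure of $\Delta_\Gamma(Y)$ in $\prod_{\mathfrak{p}\in\Gamma}\mathcal{O}_{\mathfrak{p},1}^*$. Choose $\mathfrak{p}_0\in\Gamma$ and $\sigma_0\in E_p$ that is a composite $M\to M_{\mathfrak{p}_0}\to\mathbb{C}_p$ with continuous second map, and put $S=\{\sigma_0 g: g\in G,\ g^{-1}\mathfrak{p}_0\in\Gamma\}$. Then $\overline{\Delta_\Gamma(Y)}$ is a finitely generated $\mathbb{Z}_p$-module, and for every $\sigma\in E_p$, $$\mathrm{rk}_{\mathbb{Z}_p}\,\overline{\Delta_\Gamma(Y)}=r-(t(S,\sigma)-1)^+ .$$ -/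

import Mathlib

open Filter Topology NumberField IsDedekindDomain

namespace SomeUnits

/-! ### The action of `ℤ_p` on a commutative group by limits of integer multiples -/

section PadicAction

/-- Commutative topological groups, written additively, in which `a • u` makes sense for `a ∈ ℤ_p`
as the limit of `m • u` over integers `m` tending `p`-adically to `a`. -/
class HasPadicMultiples (p : ℕ) [Fact p.Prime] (A : Type*) [AddCommGroup A] [TopologicalSpace A] :
    Prop where
  tendsto_zero : ∀ u : A, Tendsto (fun n : ℕ => ((p : ℤ) ^ n) • u) atTop (𝓝 0)
  small_multiples : ∀ V ∈ 𝓝 (0 : A), ∃ W ∈ 𝓝 (0 : A), ∀ w ∈ W, ∀ m : ℤ, m • w ∈ V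
  exists_lim : ∀ (a : ℤ_[p]) (u : A), ∃ w : A, Tendsto (fun n => (a.appr n : ℤ) • u) atTop (𝓝 w)

/-- `a • u` (that is `u ^ a` in multiplicative notation): the limit of `m • u` along the integers
`m = a.appr n`, where `a ≡ a.appr n` modulo `p ^ n`. -/
noncomputable def padicSMul (p : ℕ) [Fact p.Prime] {A : Type*} [AddCommGroup A]
    [TopologicalSpace A] (a : ℤ_[p]) (u : A) : A :=
  haveI : Nonempty A := ⟨0⟩
  limUnder atTop (fun n => (a.appr n : ℤ) • u)

theorem tendsto_appr (p : ℕ) [Fact p.Prime] {A : Type*} [AddCommGroup A]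
    [TopologicalSpace A] [HasPadicMultiples p A] (a : ℤ_[p]) (u : A) :
    Tendsto (fun n => (a.appr n : ℤ) • u) atTop (𝓝 (padicSMul p a u)) :=
  haveI : Nonempty A := ⟨0⟩
  tendsto_nhds_limUnder (HasPadicMultiples.exists_lim a u)

theorem tendsto_zsmul_zero (p : ℕ) [Fact p.Prime] {A : Type*} [AddCommGroup A]
    [TopologicalSpace A] [HasPadicMultiples p A] (k : ℕ → ℤ) (w : ℕ → A)
    (hw : Tendsto w atTop (𝓝 0)) : Tendsto (fun n => k n • w n) atTop (𝓝 0) := by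
  intro V hV
  obtain ⟨W, hW, h⟩ := HasPadicMultiples.small_multiples (p := p) V hV
  rw [Filter.mem_map]
  filter_upwards [hw hW] with n hn using h _ hn _

theorem dvd_sub_appr (p : ℕ) [Fact p.Prime] (a : ℤ_[p]) (n : ℕ) :
    (p : ℤ_[p]) ^ n ∣ a - ((a.appr n : ℤ) : ℤ_[p]) := by
  simpa using Ideal.mem_span_singleton.mp (PadicInt.appr_spec n a)

variable (p : ℕ) [Fact p.Prime] {A : Type*} [AddCommGroup A] [TopologicalSpace A]
  [IsTopologicalAddGroup A] [HasPadicMultiples p A]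

/-- The limit does not depend on the integers used to approximate `a`. -/
theorem tendsto_padicSMul {a : ℤ_[p]} {m : ℕ → ℤ}
    (hm : ∀ n, (p : ℤ_[p]) ^ n ∣ a - (m n : ℤ_[p])) (u : A) :
    Tendsto (fun n => m n • u) atTop (𝓝 (padicSMul p a u)) := by
  have h1 : ∀ n, ∃ k : ℤ, m n - (a.appr n : ℤ) = k * (p : ℤ) ^ n := by
    intro n
    have h2 := dvd_sub_appr p a n
    have h3 : (p : ℤ_[p]) ^ n ∣ ((m n - (a.appr n : ℤ) : ℤ) : ℤ_[p]) := by
      have := dvd_sub h2 (hm n)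
      convert this using 1
      push_cast
      ring
    obtain ⟨k, hk⟩ := (PadicInt.pow_p_dvd_int_iff n _).mp h3
    exact ⟨k, by rw [hk, mul_comm]⟩
  choose k hk using h1
  have h := (tendsto_zsmul_zero p k _ (HasPadicMultiples.tendsto_zero (p := p) u)).add
    (tendsto_appr p a u)
  rw [zero_add] at h
  refine h.congr fun n => ?_
  rw [← mul_smul, ← hk, ← add_smul, sub_add_cancel]

/-- The `ℤ_p`-module structure given by limits of integer multiples. -/
@[reducible] noncomputable def padicModule [T2Space A] : Module ℤ_[p] A where
  smul := padicSMul p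
  one_smul u := tendsto_nhds_unique
    (tendsto_padicSMul p (a := 1) (m := fun _ => 1) (fun n => by simp) u) (by simp)
  mul_smul a b u := by
    refine tendsto_nhds_unique (tendsto_padicSMul p (a := a * b)
      (m := fun n => (a.appr n : ℤ) * (b.appr n : ℤ)) (fun n => ?_) u) ?_
    · have := dvd_add ((dvd_sub_appr p a n).mul_right b)
        ((dvd_sub_appr p b n).mul_left ((a.appr n : ℤ) : ℤ_[p]))
      convert this using 1
      push_cast
      ring
    · have hb := (tendsto_appr p b u).sub_const (padicSMul p b u)
      rw [sub_self] at hb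
      have h := (tendsto_zsmul_zero p (fun n => (a.appr n : ℤ)) _ hb).add
        (tendsto_appr p a (padicSMul p b u))
      rw [zero_add] at h
      refine h.congr fun n => ?_
      rw [smul_sub, sub_add_cancel, mul_smul]
  smul_zero a := tendsto_nhds_unique (tendsto_appr p a 0) (by simp)
  smul_add a u v := tendsto_nhds_unique (tendsto_appr p a (u + v))
    (((tendsto_appr p a u).add (tendsto_appr p a v)).congr fun n => (smul_add _ _ _).symm)
  add_smul a b u := by
    refine tendsto_nhds_unique (tendsto_padicSMul p (a := a + b)
      (m := fun n => (a.appr n : ℤ) + (b.appr n : ℤ)) (fun n => ?_) u)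
      (((tendsto_appr p a u).add (tendsto_appr p b u)).congr fun n => (add_smul _ _ _).symm)
    have := dvd_add (dvd_sub_appr p a n) (dvd_sub_appr p b n)
    convert this using 1
    push_cast
    ring
  zero_smul u := tendsto_nhds_unique
    (tendsto_padicSMul p (a := 0) (m := fun _ => 0) (fun n => by simp) u) (by simp)

end PadicAction

/-! ### Powers of principal units -/

section NormedField

variable {F : Type*} [NormedField F] [IsUltrametricDist F]

theorem norm_eq_one_of_sub {u : F} (hu : ‖u - 1‖ < 1) : ‖u‖ = 1 := by
  have h := IsUltrametricDist.norm_add_eq_max_of_norm_ne_norm (x := u - 1) (y := 1)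
    (by rw [norm_one]; exact hu.ne)
  rwa [sub_add_cancel, norm_one, max_eq_right hu.le] at h

theorem norm_pow_sub_one_le {u : F} (hu : ‖u - 1‖ < 1) (m : ℕ) : ‖u ^ m - 1‖ ≤ ‖u - 1‖ := by
  rw [← geom_sum_mul, norm_mul]
  refine mul_le_of_le_one_left (norm_nonneg _) ?_
  refine IsUltrametricDist.norm_sum_le_of_forall_le_of_nonneg zero_le_one fun i _ => ?_
  rw [norm_pow, norm_eq_one_of_sub hu, one_pow]

theorem norm_zpow_sub_one_le {u : F} (hu : ‖u - 1‖ < 1) (m : ℤ) : ‖u ^ m - 1‖ ≤ ‖u - 1‖ := by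
  obtain ⟨n, rfl | rfl⟩ := m.eq_nat_or_neg
  · simpa using norm_pow_sub_one_le hu n
  · have h1 := norm_eq_one_of_sub hu
    have h0 : u ^ n ≠ 0 := pow_ne_zero _ (norm_ne_zero_iff.mp (by rw [h1]; exact one_ne_zero))
    have h : u ^ (-(n : ℤ)) - 1 = -((u ^ n)⁻¹ * (u ^ n - 1)) := by
      rw [zpow_neg, zpow_natCast]
      field_simp
      ring
    rw [h, norm_neg, norm_mul, norm_inv, norm_pow, h1, one_pow, inv_one, one_mul]
    exact norm_pow_sub_one_le hu n

theorem norm_pow_prime_pow_sub_one_le {p : ℕ} {u : F} (hu : ‖u - 1‖ < 1) (n : ℕ) :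
    ‖u ^ p ^ n - 1‖ ≤ max ‖(p : F)‖ ‖u - 1‖ ^ n := by
  induction n with
  | zero => simpa using hu.le
  | succ n ih =>
    have hw := norm_pow_sub_one_le hu (p ^ n)
    set w := u ^ p ^ n with hwdef
    rw [pow_succ p, pow_mul, ← hwdef, ← geom_sum_mul, norm_mul, mul_comm, pow_succ]
    refine mul_le_mul ih ?_ (norm_nonneg _) (by positivity)
    have h : ∑ i ∈ Finset.range p, w ^ i = p + ∑ i ∈ Finset.range p, (w ^ i - 1) := by
      simp
    rw [h]
    refine (IsUltrametricDist.norm_add_le_max _ _).trans (max_le_max le_rfl ?_)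
    exact IsUltrametricDist.norm_sum_le_of_forall_le_of_nonneg (norm_nonneg _) fun i _ =>
      (norm_pow_sub_one_le (hw.trans_lt hu) i).trans hw

theorem tendsto_pow_prime_pow {p : ℕ} (hp : ‖(p : F)‖ < 1) {u : F} (hu : ‖u - 1‖ < 1) :
    Tendsto (fun n => u ^ p ^ n) atTop (𝓝 1) := by
  rw [tendsto_iff_norm_sub_tendsto_zero]
  exact squeeze_zero (fun _ => norm_nonneg _) (fun n => norm_pow_prime_pow_sub_one_le hu n)
    (tendsto_pow_atTop_nhds_zero_of_lt_one (by positivity) (max_lt hp hu))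

theorem exists_tendsto_pow_appr [CompleteSpace F] {p : ℕ} [Fact p.Prime] (hp : ‖(p : F)‖ < 1)
    {u : F} (hu : ‖u - 1‖ < 1) (a : ℤ_[p]) :
    ∃ w : F, ‖w - 1‖ < 1 ∧ Tendsto (fun n => u ^ a.appr n) atTop (𝓝 w) := by
  have hu1 := norm_eq_one_of_sub hu
  have key : ∀ m n, m ≤ n → ‖u ^ a.appr n - u ^ a.appr m‖ ≤ max ‖(p : F)‖ ‖u - 1‖ ^ m := by
    intro m n hmn
    obtain ⟨k, hk⟩ := PadicInt.dvd_appr_sub_appr a m n hmn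
    have h : a.appr n = a.appr m + p ^ m * k := by
      have := PadicInt.appr_mono a hmn
      omega
    have h2 : u ^ a.appr n - u ^ a.appr m = u ^ a.appr m * ((u ^ p ^ m) ^ k - 1) := by
      rw [h, pow_add, pow_mul]
      ring
    rw [h2, norm_mul, norm_pow, hu1, one_pow, one_mul]
    exact (norm_pow_sub_one_le ((norm_pow_sub_one_le hu _).trans_lt hu) k).trans
      (norm_pow_prime_pow_sub_one_le hu m)
  have hC : CauchySeq (fun n => u ^ a.appr n) := by
    refine cauchySeq_of_le_tendsto_0' (fun m => max ‖(p : F)‖ ‖u - 1‖ ^ m) (fun m n hmn => ?_)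
      (tendsto_pow_atTop_nhds_zero_of_lt_one (by positivity) (max_lt hp hu))
    rw [dist_comm, dist_eq_norm]
    exact key m n hmn
  obtain ⟨w, hw⟩ := cauchySeq_tendsto_of_complete hC
  refine ⟨w, lt_of_le_of_lt ?_ hu, hw⟩
  exact le_of_tendsto (hw.sub_const 1).norm
    (Eventually.of_forall fun n => norm_pow_sub_one_le hu (a.appr n))

end NormedField

/-! ### Local principal units and the diagonal map -/

section Local

/-- The primes of `M` above `p`. -/
abbrev PrimesAbove (p : ℕ) (M : Type*) [Field M] [NumberField M] : Type _ :=
  {v : HeightOneSpectrum (𝓞 M) // (p : 𝓞 M) ∈ v.asIdeal}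

variable {p : ℕ} {M : Type*} [Field M] [NumberField M]

/-- The group of principal local units `1 + π 𝓞_𝔭` at a prime `𝔭` above `p`, as a subgroup
of the multiplicative group of the completion `M_𝔭` (with the `𝔭`-adic topology). -/
noncomputable abbrev principalUnits (v : PrimesAbove p M) : Subgroup (v.1.adicCompletion M)ˣ :=
  (v.1.adicCompletionIntegers M).principalUnitGroup

/-- The group of principal local units, written additively. -/
abbrev LocalUnits (v : PrimesAbove p M) : Type _ := Additive (principalUnits v)

theorem mem_principalUnits_iff (v : PrimesAbove p M) (u : (v.1.adicCompletion M)ˣ) :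
    u ∈ principalUnits v ↔ ‖(u : v.1.adicCompletion M) - 1‖ < 1 := by
  rw [ValuationSubring.mem_principalUnitGroup_iff]
  refine Iff.trans ?_ (Valued.toNormedField.norm_lt_one_iff (L := v.1.adicCompletion M)).symm
  exact (Valuation.isEquiv_iff_val_lt_one.mp
    (Valuation.isEquiv_valuation_valuationSubring
      (Valued.v : Valuation (v.1.adicCompletion M) _))).symm

theorem norm_natCast_lt_one (v : PrimesAbove p M) : ‖(p : v.1.adicCompletion M)‖ < 1 := by
  have h := (FinitePlace.norm_lt_one_iff_mem M v.1 (p : 𝓞 M)).mpr v.2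
  simpa using h

instance (v : PrimesAbove p M) : T2Space (LocalUnits v) :=
  inferInstanceAs (T2Space (principalUnits v))

theorem isEmbedding_coe (v : PrimesAbove p M) :
    IsEmbedding (fun u : LocalUnits v =>
      ((u.toMul : (v.1.adicCompletion M)ˣ) : v.1.adicCompletion M)) :=
  Units.isEmbedding_val₀.comp IsEmbedding.subtypeVal

theorem norm_coe_sub_one_lt (v : PrimesAbove p M) (u : LocalUnits v) :
    ‖((u.toMul : (v.1.adicCompletion M)ˣ) : v.1.adicCompletion M) - 1‖ < 1 :=
  (mem_principalUnits_iff v _).mp u.toMul.2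

instance [Fact p.Prime] (v : PrimesAbove p M) : HasPadicMultiples p (LocalUnits v) where
  tendsto_zero u := by
    rw [(isEmbedding_coe v).tendsto_nhds_iff]
    refine (tendsto_pow_prime_pow (norm_natCast_lt_one v) (norm_coe_sub_one_lt v u)).congr
      fun n => ?_
    simp only [Function.comp_apply, toMul_zsmul, SubgroupClass.coe_zpow, Units.val_zpow_eq_zpow_val]
    rw [← zpow_natCast, Nat.cast_pow]
  small_multiples V hV := by
    rw [(isEmbedding_coe v).nhds_eq_comap, mem_comap] at hV
    obtain ⟨T, hT, hTV⟩ := hV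
    obtain ⟨ε, hε, hball⟩ := Metric.mem_nhds_iff.mp hT
    refine ⟨_, (isEmbedding_coe v).continuous.continuousAt.preimage_mem_nhds
      (Metric.ball_mem_nhds _ hε), fun w hw m => hTV (hball ?_)⟩
    have h := norm_zpow_sub_one_le (norm_coe_sub_one_lt v w) m
    simp only [Set.mem_preimage, Metric.mem_ball, dist_eq_norm, toMul_zero, OneMemClass.coe_one,
      Units.val_one, toMul_zsmul, SubgroupClass.coe_zpow, Units.val_zpow_eq_zpow_val] at hw ⊢
    exact h.trans_lt hw
  exists_lim a u := by
    obtain ⟨w, hw, hlim⟩ := exists_tendsto_pow_appr (norm_natCast_lt_one v)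
      (norm_coe_sub_one_lt v u) a
    have hw0 : w ≠ 0 := norm_ne_zero_iff.mp (by rw [norm_eq_one_of_sub hw]; exact one_ne_zero)
    refine ⟨Additive.ofMul ⟨Units.mk0 w hw0, (mem_principalUnits_iff v _).mpr hw⟩, ?_⟩
    rw [(isEmbedding_coe v).tendsto_nhds_iff]
    exact hlim.congr fun n => by simp

/-- The `ℤ_p`-module structure on principal local units, `a • u` being the power `u ^ a`. -/
noncomputable instance [Fact p.Prime] (v : PrimesAbove p M) : Module ℤ_[p] (LocalUnits v) :=
  padicModule p

/-- The diagonal map `Δ_Γ` from the global units to the product of the completions in `Γ`. -/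
noncomputable def diagonal (Γ : Set (PrimesAbove p M)) :
    (𝓞 M)ˣ →* (∀ v : Γ, (v.1.1.adicCompletion M)ˣ) :=
  MonoidHom.pi fun v => Units.map (algebraMap (𝓞 M) (v.1.1.adicCompletion M) : _ →* _)

/-- `Y`: the global units which are principal units at all primes in `Γ`. -/
noncomputable def unitsY (Γ : Set (PrimesAbove p M)) : Subgroup (𝓞 M)ˣ :=
  (Subgroup.pi Set.univ fun v : Γ => principalUnits v.1).comap (diagonal Γ)

/-- The restriction of `Δ_Γ` to `Y`, with values in the product of the groups of principal
local units (written additively, with the product topology). -/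
noncomputable def diagonalY (Γ : Set (PrimesAbove p M)) :
    Additive (unitsY Γ) →+ (∀ v : Γ, LocalUnits v.1) where
  toFun u v := Additive.ofMul ⟨diagonal Γ u.toMul v, u.toMul.2 v (Set.mem_univ v)⟩
  map_zero' := by
    ext v
    simp
  map_add' a b := by
    ext v
    simp

/-- The closure of `Δ_Γ(Y)` in the product of the groups of principal local units at the primes
in `Γ`, as a `ℤ_p`-submodule. -/
noncomputable def closureDiagonalY [Fact p.Prime] (Γ : Set (PrimesAbove p M)) :
    Submodule ℤ_[p] (∀ v : Γ, LocalUnits v.1) where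
  carrier := closure (Set.range (diagonalY Γ))
  zero_mem' := (diagonalY Γ).range.topologicalClosure.zero_mem
  add_mem' := (diagonalY Γ).range.topologicalClosure.add_mem
  smul_mem' a u hu := by
    have hlim : Tendsto (fun n => (a.appr n : ℤ) • u) atTop (𝓝 (a • u)) :=
      tendsto_pi_nhds.mpr fun v => tendsto_appr p a (u v)
    exact isClosed_closure.mem_of_tendsto hlim (Eventually.of_forall fun n =>
      (diagonalY Γ).range.topologicalClosure.zsmul_mem hu _)

end Local

/-! ### The `p`-adic logarithm and the two conjectures -/

section Log

/-- The power series `∑_{n ≥ 1} (-1)^(n+1) (x - 1)^n / n`, which converges for `‖x - 1‖ < 1`. -/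
noncomputable def padicLogSeries (p : ℕ) [Fact p.Prime] (x : ℂ_[p]) : ℂ_[p] :=
  ∑' n : ℕ, (-1) ^ n * (x - 1) ^ (n + 1) / ((n : ℂ_[p]) + 1)

open Classical in
/-- The `p`-adic logarithm on `ℂ_p^*`: the power series on the disc `‖x - 1‖ < 1`, extended to
all `x ≠ 0` as a homomorphism that kills roots of unity and `p`. Some `x ^ n * p ^ s` with `n ≥ 1`
lies in the disc, so that `log x` has to be `log (x ^ n * p ^ s) / n`, and this value does not
depend on the choice of `n` and `s`. The value at `0` is immaterial. -/
noncomputable def padicLog (p : ℕ) [Fact p.Prime] (x : ℂ_[p]) : ℂ_[p] :=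
  if ‖x - 1‖ < 1 then padicLogSeries p x
  else if h : ∃ k : ℕ × ℤ, 0 < k.1 ∧ ‖x ^ k.1 * (p : ℂ_[p]) ^ k.2 - 1‖ < 1 then
    padicLogSeries p (x ^ h.choose.1 * (p : ℂ_[p]) ^ h.choose.2) / (h.choose.1 : ℂ_[p])
  else 0

/-- Schanuel's conjecture in logarithmic form: if the nonzero algebraic numbers `α i` are such that
for every choice of the multivalued logarithm the `log (α i)` are linearly independent over `ℚ`,
then the `log (α i)` are algebraically independent over `ℚ`. -/
def SchanuelConjecture : Prop :=
  ∀ (n : ℕ) (α : Fin n → ℂ), (∀ i, α i ≠ 0) → (∀ i, IsAlgebraic ℚ (α i)) →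
    (∀ L : Fin n → ℂ, (∀ i, Complex.exp (L i) = α i) → LinearIndependent ℚ L) →
    ∀ L : Fin n → ℂ, (∀ i, Complex.exp (L i) = α i) → AlgebraicIndependent ℚ L

/-- The `p`-adic Schanuel conjecture in logarithmic form. -/
def PadicSchanuelConjecture (p : ℕ) [Fact p.Prime] : Prop :=
  ∀ (n : ℕ) (α : Fin n → ℂ_[p]), (∀ i, α i ≠ 0) → (∀ i, IsAlgebraic ℚ (α i)) →
    LinearIndependent ℚ (fun i => padicLog p (α i)) →
    AlgebraicIndependent ℚ (fun i => padicLog p (α i))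

end Log

/-! ### Embeddings, units and cosets -/

section Embeddings

variable {p : ℕ} [Fact p.Prime] {M : Type*} [Field M] [NumberField M]

/-- A weak Minkowski unit: its Galois conjugates generate a subgroup of finite index. -/
def IsWeakMinkowskiUnit (ε : (𝓞 M)ˣ) : Prop :=
  (Subgroup.closure (Set.range fun g : M ≃ₐ[ℚ] M =>
    Units.map (RingOfIntegers.mapRingHom (g : M →+* M) : 𝓞 M →* 𝓞 M) ε)).FiniteIndex

/-- The matrix `(log_p (σ g ε))` with rows indexed by `σ ∈ S` and columns by the Galois group. -/
noncomputable def padicLogMatrix (S : Set (M →+* ℂ_[p])) (ε : (𝓞 M)ˣ) :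
    Matrix S (M ≃ₐ[ℚ] M) ℂ_[p] :=
  Matrix.of fun σ g => padicLog p (σ.1 (g ((ε : 𝓞 M) : M)))

/-- `J_σ`: the `g` for which `σ g` is not in `S`. -/
def complementJ (S : Set (M →+* ℂ_[p])) (σ : M →+* ℂ_[p]) : Set (M ≃ₐ[ℚ] M) :=
  {g | σ.comp (g : M →+* M) ∉ S}

/-- The number of right cosets `{g, c g}` of `{id, c}` that are contained in `J`. -/
noncomputable def cosetCount (c : M ≃ₐ[ℚ] M) (J : Set (M ≃ₐ[ℚ] M)) : ℕ :=
  {A : Set (M ≃ₐ[ℚ] M) | (∃ g, A = {g, c * g}) ∧ A ⊆ J}.ncard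

/-- `c` is induced by complex conjugation: `τ c` is the complex conjugate of `τ` for some
embedding `τ` of `M` into `ℂ`. -/
def IsInducedByConj (c : M ≃ₐ[ℚ] M) : Prop :=
  ∃ τ : M →+* ℂ, ComplexEmbedding.IsConj τ c

/-- `σ₀` is a composite `M → M_𝔭 → ℂ_p` with a continuous second map. -/
def FactorsThroughCompletion (v : PrimesAbove p M) (σ₀ : M →+* ℂ_[p]) : Prop :=
  ∃ ι : v.1.adicCompletion M →+* ℂ_[p], Continuous ι ∧
    σ₀ = ι.comp (algebraMap M (v.1.adicCompletion M))

/-- `S_p = {σ₀ g | g⁻¹ 𝔭₀ ∈ Γ}`, where `g⁻¹ 𝔭₀` is the preimage of `𝔭₀` under `g`. -/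
def rowSet (Γ : Set (PrimesAbove p M)) (v₀ : PrimesAbove p M) (σ₀ : M →+* ℂ_[p]) :
    Set (M →+* ℂ_[p]) :=
  {σ | ∃ g : M ≃ₐ[ℚ] M, σ = σ₀.comp (g : M →+* M) ∧
    ∃ v ∈ Γ, v.1.asIdeal = v₀.1.asIdeal.comap (RingOfIntegers.mapRingHom (g : M →+* M))}

end Embeddings

end SomeUnits

namespace SomeUnits

/-! ### The logarithm on the open unit disc -/

section PadicLog

variable {p : ℕ} [Fact p.Prime]

/-! Complex conjugation commutes with all embeddings of a CM field, so `c` is central and H = G/⟨c⟩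
has order r + 1. For a unit u, u/c(u) is a root of unity and the norm of u is ±1. Hence L(x) =
log_p(σxε) is a function on H with sum zero, and the row of σx in the matrix has entries L(xg). The
logarithm on the unit disc kills only torsion, so a weak Minkowski unit makes the r values L(x), x ≠
1, linearly independent over ℚ, and the p-adic Schanuel conjecture makes them algebraically
independent. The matrix is thus the generic group matrix of H subject to sum zero: any proper set of
its rows is independent (`linearIndependent_translates`), and all r + 1 rows sum to zero. If m is
the number of classes in H of the g with σg ∈ S, the rank is min(m, r); since m = r + 1 - t, this is
the asserted value.

For the closure, S is the set of embeddings whose prime lies in Γ. A finitely generated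
ℤ_p-submodule is compact, so the closure is the ℤ_p-span of Δ(Y). The logarithm on local principal
units is ℤ_p-linear with torsion kernel, so the rank is the ℚ_p-dimension of the span W of the
logarithm vectors of Y. Vectors independent over ℚ_p may become dependent over ℂ_p, so the matrix
rank only gives dim W ≥ min(m, r). Conversely, r conjugates of one unit span W, so dim W ≤ r.
Moreover log u = ½ log(u·c(u)) comes from the maximal real subfield K, and the ℚ_p-span of K in the
product over the embeddings of K below Γ has dimension at most their number
(`finrank_restrict_embeddingSpan_le`), which is at most m.

The auxiliary unit used in the second half comes from a Dirichlet unit and a diagonally dominant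
matrix (`exists_hasIndependentConjugates`), raised to a power that lies in the disc. -/

theorem norm_natCast_complex (n : ℕ) : ‖(n : ℂ_[p])‖ = ‖(n : ℚ_[p])‖ := by
  rw [← map_natCast (algebraMap ℚ_[p] ℂ_[p]) n, norm_algebraMap']

theorem norm_natCast_complex_le_one (n : ℕ) : ‖(n : ℂ_[p])‖ ≤ 1 := by
  rw [norm_natCast_complex]
  exact_mod_cast Padic.norm_int_le_one (p := p) (n : ℤ)

theorem norm_prime_complex_lt_one : ‖(p : ℂ_[p])‖ < 1 := by
  rw [norm_natCast_complex]
  exact Padic.norm_p_lt_one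

theorem inv_norm_natCast_le {n : ℕ} (hn : n ≠ 0) : ‖(n : ℂ_[p])‖⁻¹ ≤ n := by
  have h0 : (n : ℚ_[p]) ≠ 0 := Nat.cast_ne_zero.mpr hn
  rw [norm_natCast_complex, Padic.norm_eq_zpow_neg_valuation h0, Padic.valuation_natCast,
    zpow_neg, inv_inv, zpow_natCast]
  exact_mod_cast Nat.le_of_dvd (Nat.pos_of_ne_zero hn) pow_padicValNat_dvd

/-- The crude bound 1/|n| ≤ n gives one majorant for all coefficients of norm at most 1, as
dominated convergence requires. -/
theorem norm_logTerm_le (a t : ℂ_[p]) (ha : ‖a‖ ≤ 1) (k : ℕ) :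
    ‖a * t ^ (k + 1) / ((k : ℂ_[p]) + 1)‖ ≤ ((k + 1 : ℕ) : ℝ) * ‖t‖ ^ (k + 1) := by
  have h := inv_norm_natCast_le (p := p) (Nat.succ_ne_zero k)
  rw [norm_div, norm_mul, norm_pow, div_eq_mul_inv, mul_comm _ (‖_‖⁻¹)]
  push_cast at h ⊢
  refine mul_le_mul h ?_ (by positivity) (by positivity)
  exact mul_le_of_le_one_left (by positivity) ha

theorem summable_logBound {t : ℝ} (h0 : 0 ≤ t) (ht : t < 1) :
    Summable fun k : ℕ => ((k + 1 : ℕ) : ℝ) * t ^ (k + 1) := by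
  have h := summable_pow_mul_geometric_of_norm_lt_one (R := ℝ) 1 (r := t)
    (by rwa [Real.norm_of_nonneg h0])
  simpa using (summable_nat_add_iff 1).mpr h

theorem summable_logSeries {t : ℂ_[p]} (ht : ‖t‖ < 1) :
    Summable fun k : ℕ => (-1) ^ k * t ^ (k + 1) / ((k : ℂ_[p]) + 1) :=
  Summable.of_norm_bounded (summable_logBound (norm_nonneg t) ht)
    fun k => norm_logTerm_le _ t (by simp) k

/-- With N = p ^ n, Pascal's rule gives C(N-1, k+1) = N·C(N-1, k)/(k+1) - C(N-1, k), and N tends to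
0, so each step only flips the sign. -/
theorem tendsto_choose_prime_pow_sub_one (k : ℕ) :
    Tendsto (fun n : ℕ => (((p ^ n - 1).choose k : ℕ) : ℂ_[p])) atTop (𝓝 ((-1) ^ k)) := by
  have hp0 : Tendsto (fun n : ℕ => (p : ℂ_[p]) ^ n) atTop (𝓝 0) :=
    tendsto_pow_atTop_nhds_zero_of_norm_lt_one norm_prime_complex_lt_one
  induction k with
  | zero => simp
  | succ k ih =>
    have h := ((hp0.mul ih).div_const ((k : ℂ_[p]) + 1)).sub ih
    have e : 0 * (-1 : ℂ_[p]) ^ k / ((k : ℂ_[p]) + 1) - (-1) ^ k = (-1) ^ (k + 1) := by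
      rw [pow_succ]; ring
    rw [e] at h
    refine h.congr fun n => ?_
    obtain ⟨m, hm⟩ : ∃ m, p ^ n = m + 1 :=
      Nat.exists_eq_succ_of_ne_zero (pow_ne_zero _ (Fact.out : p.Prime).ne_zero)
    have h1 : ((m : ℂ_[p]) + 1) * (m.choose k : ℂ_[p]) = ((m + 1).choose (k + 1) : ℂ_[p]) * (k + 1) := by
      exact_mod_cast Nat.add_one_mul_choose_eq m k
    have h2 : ((m + 1).choose (k + 1) : ℂ_[p]) = m.choose k + m.choose (k + 1) := by
      exact_mod_cast Nat.choose_succ_succ' m k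
    have h3 : (p : ℂ_[p]) ^ n = m + 1 := by exact_mod_cast hm
    have h4 : (k : ℂ_[p]) + 1 ≠ 0 := by exact_mod_cast Nat.succ_ne_zero k
    rw [hm, Nat.add_sub_cancel, h3, h1, mul_div_cancel_right₀ _ h4, h2]
    ring

/-- The binomial theorem and C(N, k+1)/N = C(N-1, k)/(k+1): the logarithm series with C(N-1, k) in
place of (-1)^k. -/
theorem tsum_choose_eq (t : ℂ_[p]) (n : ℕ) :
    ∑' k : ℕ, ((p ^ n - 1).choose k : ℂ_[p]) * t ^ (k + 1) / ((k : ℂ_[p]) + 1)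
      = ((1 + t) ^ p ^ n - 1) / (p : ℂ_[p]) ^ n := by
  obtain ⟨m, hm⟩ : ∃ m, p ^ n = m + 1 :=
    Nat.exists_eq_succ_of_ne_zero (pow_ne_zero _ (Fact.out : p.Prime).ne_zero)
  have h3 : (p : ℂ_[p]) ^ n = m + 1 := by exact_mod_cast hm
  have h5 : (m : ℂ_[p]) + 1 ≠ 0 := by exact_mod_cast Nat.succ_ne_zero m
  rw [hm, h3, Nat.add_sub_cancel, tsum_eq_sum (s := Finset.range (m + 1)), add_comm 1 t, add_pow,
    Finset.sum_range_succ' _ (m + 1)]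
  · simp only [one_pow, mul_one, pow_zero, Nat.choose_zero_right, Nat.cast_one, add_sub_cancel_right]
    rw [Finset.sum_div]
    refine Finset.sum_congr rfl fun k _ => ?_
    have h1 : ((m : ℂ_[p]) + 1) * (m.choose k : ℂ_[p]) = ((m + 1).choose (k + 1) : ℂ_[p]) * (k + 1) := by
      exact_mod_cast Nat.add_one_mul_choose_eq m k
    have h4 : (k : ℂ_[p]) + 1 ≠ 0 := by exact_mod_cast Nat.succ_ne_zero k
    rw [div_eq_div_iff h4 h5]
    linear_combination t ^ (k + 1) * h1
  · intro k hk
    rw [Nat.choose_eq_zero_of_lt (by simpa using hk)]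
    simp

/-- On the open unit disc the logarithm is `lim (x ^ (p ^ n) - 1) / p ^ n`. -/
theorem tendsto_padicLogSeries {x : ℂ_[p]} (hx : ‖x - 1‖ < 1) :
    Tendsto (fun n : ℕ => (x ^ p ^ n - 1) / (p : ℂ_[p]) ^ n) atTop (𝓝 (padicLogSeries p x)) := by
  have h := tendsto_tsum_of_dominated_convergence (𝓕 := atTop)
    (f := fun (n k : ℕ) => ((p ^ n - 1).choose k : ℂ_[p]) * (x - 1) ^ (k + 1) / ((k : ℂ_[p]) + 1))
    (g := fun k : ℕ => (-1) ^ k * (x - 1) ^ (k + 1) / ((k : ℂ_[p]) + 1))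
    (summable_logBound (norm_nonneg (x - 1)) hx)
    (fun k => ((tendsto_choose_prime_pow_sub_one k).mul_const _).div_const _)
    (Eventually.of_forall fun n k => norm_logTerm_le _ _ (norm_natCast_complex_le_one _) k)
  refine h.congr fun n => ?_
  rw [tsum_choose_eq, add_sub_cancel]

theorem padicLog_of_norm_lt {x : ℂ_[p]} (hx : ‖x - 1‖ < 1) : padicLog p x = padicLogSeries p x :=
  if_pos hx

theorem tendsto_padicLog {x : ℂ_[p]} (hx : ‖x - 1‖ < 1) :
    Tendsto (fun n : ℕ => (x ^ p ^ n - 1) / (p : ℂ_[p]) ^ n) atTop (𝓝 (padicLog p x)) := by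
  rw [padicLog_of_norm_lt hx]
  exact tendsto_padicLogSeries hx

theorem norm_mul_sub_one_lt {F : Type*} [NormedField F] [IsUltrametricDist F] {x y : F}
    (hx : ‖x - 1‖ < 1) (hy : ‖y - 1‖ < 1) : ‖x * y - 1‖ < 1 := by
  have e : x * y - 1 = x * (y - 1) + (x - 1) := by ring
  rw [e]
  refine (IsUltrametricDist.norm_add_le_max _ _).trans_lt (max_lt ?_ hx)
  rwa [norm_mul, norm_eq_one_of_sub hx, one_mul]

/-- With N = p ^ n, (xy)^N - 1 = (x^N - 1) + x^N (y^N - 1); divide by N and let x^N tend to 1. -/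
theorem padicLog_mul {x y : ℂ_[p]} (hx : ‖x - 1‖ < 1) (hy : ‖y - 1‖ < 1) :
    padicLog p (x * y) = padicLog p x + padicLog p y := by
  refine tendsto_nhds_unique (tendsto_padicLog (norm_mul_sub_one_lt hx hy)) ?_
  have h1 : Tendsto (fun n => x ^ p ^ n) atTop (𝓝 1) :=
    tendsto_pow_prime_pow norm_prime_complex_lt_one hx
  have h := (tendsto_padicLog hx).add (h1.mul (tendsto_padicLog hy))
  rw [one_mul] at h
  refine h.congr fun n => ?_
  rw [mul_pow]
  ring

theorem padicLog_one : padicLog p (1 : ℂ_[p]) = 0 := by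
  have h := padicLog_mul (p := p) (x := 1) (y := 1) (by simp) (by simp)
  rw [one_mul] at h
  simpa using h

theorem norm_pow_sub_one_lt {F : Type*} [NormedField F] [IsUltrametricDist F] {x : F}
    (hx : ‖x - 1‖ < 1) (n : ℕ) : ‖x ^ n - 1‖ < 1 :=
  (norm_pow_sub_one_le hx n).trans_lt hx

theorem padicLog_pow {x : ℂ_[p]} (hx : ‖x - 1‖ < 1) (n : ℕ) :
    padicLog p (x ^ n) = n * padicLog p x := by
  induction n with
  | zero => simp [padicLog_one]
  | succ n ih =>
    rw [pow_succ, padicLog_mul (norm_pow_sub_one_lt hx n) hx, ih]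
    push_cast
    ring

theorem nat_succ_succ_mul_pow_le (k : ℕ) : ((k + 1 + 1 : ℕ) : ℝ) * (1 / 4) ^ (k + 1) ≤ 1 / 2 := by
  induction k with
  | zero => norm_num
  | succ k ih =>
    rw [pow_succ]
    push_cast at ih ⊢
    have : (0 : ℝ) ≤ (1 / 4) ^ (k + 1) := by positivity
    nlinarith [mul_nonneg (Nat.cast_nonneg (α := ℝ) k) this]

/-- On this disc the linear term dominates the tail even with the crude bound 1/|n| ≤ n. The radius
1/4 is not optimal but serves every p. -/
theorem norm_padicLog {x : ℂ_[p]} (hx : ‖x - 1‖ ≤ 1 / 4) : ‖padicLog p x‖ = ‖x - 1‖ := by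
  have hx1 : ‖x - 1‖ < 1 := by linarith
  rcases eq_or_ne x 1 with rfl | hne
  · simp [padicLog_one]
  have hpos : 0 < ‖x - 1‖ := norm_pos_iff.mpr (sub_ne_zero.mpr hne)
  have hs := summable_logSeries hx1
  rw [padicLog_of_norm_lt hx1, padicLogSeries, hs.tsum_eq_zero_add]
  have hb : ‖∑' k : ℕ, (-1) ^ (k + 1) * (x - 1) ^ (k + 1 + 1) / (((k + 1 : ℕ) : ℂ_[p]) + 1)‖
      ≤ ‖x - 1‖ / 2 := by
    refine IsUltrametricDist.norm_tsum_le_of_forall_le_of_nonneg (by positivity) fun k => ?_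
    refine (norm_logTerm_le _ _ (by simp) (k + 1)).trans ?_
    calc ((k + 1 + 1 : ℕ) : ℝ) * ‖x - 1‖ ^ (k + 1 + 1)
        = (((k + 1 + 1 : ℕ) : ℝ) * ‖x - 1‖ ^ (k + 1)) * ‖x - 1‖ := by rw [pow_succ _ (k + 1)]; ring
      _ ≤ (((k + 1 + 1 : ℕ) : ℝ) * (1 / 4) ^ (k + 1)) * ‖x - 1‖ := by gcongr
      _ ≤ 1 / 2 * ‖x - 1‖ := by gcongr; exact nat_succ_succ_mul_pow_le k
      _ = ‖x - 1‖ / 2 := by ring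
  simp only [pow_zero, zero_add, pow_one, one_mul, Nat.cast_zero, div_one]
  rw [IsUltrametricDist.norm_add_eq_max_of_norm_ne_norm, max_eq_left]
  · linarith
  · exact (lt_of_le_of_lt hb (by linarith)).ne'

/-- Some power x ^ p ^ n enters the disc where the logarithm preserves the distance to 1, so it
vanishes there only at 1. -/
theorem exists_pow_prime_pow_eq_one_of_padicLog_eq_zero {x : ℂ_[p]} (hx : ‖x - 1‖ < 1)
    (h : padicLog p x = 0) : ∃ n : ℕ, x ^ p ^ n = 1 := by
  have h1 : Tendsto (fun n => x ^ p ^ n) atTop (𝓝 1) :=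
    tendsto_pow_prime_pow norm_prime_complex_lt_one hx
  obtain ⟨n, hn⟩ := (h1.eventually (Metric.closedBall_mem_nhds 1 (by norm_num : (0:ℝ) < 1 / 4))).exists
  rw [dist_eq_norm] at hn
  refine ⟨n, ?_⟩
  have h2 := norm_padicLog hn
  rw [padicLog_pow hx, h, mul_zero, norm_zero] at h2
  exact sub_eq_zero.mp (norm_eq_zero.mp h2.symm)

theorem continuousAt_padicLog {x : ℂ_[p]} (hx : ‖x - 1‖ < 1) : ContinuousAt (padicLog p) x := by
  have hx1 := norm_eq_one_of_sub hx
  have hx0 : x ≠ 0 := norm_ne_zero_iff.mp (by rw [hx1]; exact one_ne_zero)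
  rw [Metric.continuousAt_iff]
  intro ε hε
  refine ⟨min ε (1 / 4), by positivity, fun y hy => ?_⟩
  rw [dist_eq_norm] at hy ⊢
  have e : y / x - 1 = (y - x) / x := by field_simp
  have hz : ‖y / x - 1‖ = ‖y - x‖ := by rw [e, norm_div, hx1, div_one]
  have hz4 : ‖y / x - 1‖ ≤ 1 / 4 := hz ▸ (hy.trans_le (min_le_right _ _)).le
  have h := padicLog_mul hx (y := y / x) (by linarith)
  rw [mul_div_cancel₀ _ hx0] at h
  rw [h, add_sub_cancel_left, norm_padicLog hz4, hz]
  exact hy.trans_le (min_le_left _ _)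

end PadicLog

/-! ### Linear algebra -/

section LinearAlgebra

/-- The generic group matrix of trace-zero indeterminates: any proper subset of the rows of
`(L (x * g))` is linearly independent. -/
theorem linearIndependent_translates {H K : Type*} [Group H] [Finite H] [Field K] [CharZero K]
    (L : H → K) (hsum : ∑ᶠ x, L x = 0)
    (hL : AlgebraicIndependent ℚ fun x : {x : H // x ≠ 1} => L x) {T : Set H} (hT : T ≠ Set.univ) :
    LinearIndependent K fun (x : T) (g : H) => L (x * g) := by
  classical
  have := Fintype.ofFinite H
  rw [finsum_eq_sum_of_fintype] at hsum
  obtain ⟨h₀, hh₀⟩ := (Set.ne_univ_iff_exists_notMem T).mp hT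
  -- The sum-zero relation determines the variable at 1 from the others.
  let X : H → MvPolynomial {x : H // x ≠ 1} ℚ := fun x =>
    if h : x = 1 then -∑ y, MvPolynomial.X y else MvPolynomial.X ⟨x, h⟩
  have hsub : ∀ f : H → K, ∑ y : {x : H // x ≠ 1}, f y = (∑ x, f x) - f 1 := fun f => by
    rw [← Finset.sum_subtype (Finset.univ.erase (1 : H)) (by simp) f,
      ← Finset.add_sum_erase Finset.univ f (Finset.mem_univ 1)]
    ring
  have hXL : ∀ x, MvPolynomial.aeval (fun x : {x : H // x ≠ 1} => L x) (X x) = L x := by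
    intro x
    by_cases h : x = 1
    · simp only [X, h, dite_true, map_neg, map_sum, MvPolynomial.aeval_X]
      rw [hsub L, hsum]
      ring
    · simp [X, h]
  -- With every indeterminate equal to -1, the group matrix (X (h * h'⁻¹)) becomes |H|·I minus the
  -- all-ones matrix.
  have hXe : ∀ x, MvPolynomial.aeval (fun _ : {x : H // x ≠ 1} => (-1 : K)) (X x)
      = (if x = 1 then (Fintype.card H : K) else 0) - 1 := by
    intro x
    by_cases h : x = 1
    · simp only [X, h, dite_true, map_neg, map_sum, MvPolynomial.aeval_X]
      rw [hsub fun _ => -1]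
      simp only [Finset.sum_const, Finset.card_univ, nsmul_eq_mul, if_true]
      ring
    · simp [X, h]
  -- Subtracting the column of the missing element `h₀` cancels the all-ones part, so the
  -- specialisation is |H|·I and `N.det` is a nonzero polynomial.
  let N : Matrix T T (MvPolynomial {x : H // x ≠ 1} ℚ) :=
    Matrix.of fun h h' => X (h * (h' : H)⁻¹) - X (h * h₀⁻¹)
  have hN : N.det ≠ 0 := by
    intro h
    have h1 := congrArg (MvPolynomial.aeval (fun _ : {x : H // x ≠ 1} => (-1 : K))) h
    rw [map_zero, AlgHom.map_det] at h1
    have h2 : (AlgHom.mapMatrix (MvPolynomial.aeval (fun _ : {x : H // x ≠ 1} => (-1 : K)))) N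
        = (Fintype.card H : K) • (1 : Matrix T T K) := by
      ext i j
      have h3 : (i : H) ≠ h₀ := fun h => hh₀ (h ▸ i.2)
      simp only [N, AlgHom.mapMatrix_apply, Matrix.map_apply, Matrix.of_apply, map_sub, hXe,
        mul_inv_eq_one, Matrix.smul_apply, Matrix.one_apply, if_neg h3, smul_eq_mul, mul_ite,
        mul_one, mul_zero, Subtype.coe_inj]
      ring
    rw [h2, Matrix.det_smul, Matrix.det_one, mul_one] at h1
    exact pow_ne_zero _ (Nat.cast_ne_zero.mpr Fintype.card_ne_zero) h1
  have hdet : ((AlgHom.mapMatrix (MvPolynomial.aeval fun x : {x : H // x ≠ 1} => L x)) N).det ≠ 0 := by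
    rw [← AlgHom.map_det]
    exact fun h => hN (hL (by rw [h, map_zero]))
  rw [Fintype.linearIndependent_iff]
  intro c hc
  have hv : Matrix.vecMul c
      ((AlgHom.mapMatrix (MvPolynomial.aeval fun x : {x : H // x ≠ 1} => L x)) N) = 0 := by
    ext j
    have e1 := congrFun hc (j : H)⁻¹
    have e2 := congrFun hc h₀⁻¹
    simp only [Finset.sum_apply, Pi.smul_apply, smul_eq_mul, Pi.zero_apply] at e1 e2
    simp only [Matrix.vecMul, dotProduct, N, AlgHom.mapMatrix_apply, Matrix.map_apply,
      Matrix.of_apply, map_sub, hXL, mul_sub, Finset.sum_sub_distrib, e1, e2, sub_zero,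
      Pi.zero_apply]
  exact fun i => congrFun (Matrix.eq_zero_of_vecMul_eq_zero hdet hv) i

/-- A family of `rank A` elements which generates `A` up to torsion is linearly independent. -/
theorem linearIndependent_of_card_eq_finrank {ι A : Type*} [Fintype ι] [AddCommGroup A]
    [Module.Finite ℤ A] (v : ι → A) (hcard : Fintype.card ι = Module.finrank ℤ A)
    (hv : ∀ a, ∃ n : ℤ, n ≠ 0 ∧ n • a ∈ Submodule.span ℤ (Set.range v)) :
    LinearIndependent ℤ v := by
  have h1 : Module.finrank ℤ (A ⧸ Submodule.span ℤ (Set.range v)) = 0 := by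
    rw [Module.finrank_eq_zero_iff]
    intro x
    obtain ⟨a, rfl⟩ := Submodule.Quotient.mk_surjective _ x
    obtain ⟨n, hn, h⟩ := hv a
    exact ⟨n, hn, by rwa [← Submodule.Quotient.mk_smul, Submodule.Quotient.mk_eq_zero]⟩
  have h2 := Submodule.finrank_quotient_add_finrank (Submodule.span ℤ (Set.range v))
  have h3 := Submodule.finrank_quotient_add_finrank (LinearMap.ker (Fintype.linearCombination ℤ v))
  rw [(Fintype.linearCombination ℤ v).quotKerEquivRange.finrank_eq,
    Fintype.range_linearCombination, Module.finrank_fintype_fun_eq_card] at h3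
  have h4 : Module.finrank ℤ (LinearMap.ker (Fintype.linearCombination ℤ v)) = 0 := by omega
  have h5 : LinearMap.ker (Fintype.linearCombination ℤ v) = ⊥ := by
    rw [← Submodule.finrank_eq_zero (R := ℤ)]
    exact h4
  exact linearIndependent_iff_injective_fintypeLinearCombination.mpr (LinearMap.ker_eq_bot.mp h5)

/-- A `k`-basis of `U` still spans over `F`, though it may become dependent there. -/
theorem finrank_span_le_finrank {k F X : Type*} [Field k] [Field F] [Algebra k F] [AddCommGroup X]
    [Module k X] [Module F X] [IsScalarTower k F X] (U : Submodule k X) [FiniteDimensional k U] :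
    Module.finrank F (Submodule.span F (U : Set X)) ≤ Module.finrank k U := by
  let b := Module.finBasis k U
  have h : Submodule.span F (U : Set X) ≤ Submodule.span F (Set.range fun i => (b i : X)) := by
    rw [Submodule.span_le]
    intro u hu
    have h1 := congrArg (U.subtype) (b.sum_repr ⟨u, hu⟩)
    simp only [map_sum, map_smul, Submodule.subtype_apply] at h1
    rw [← h1]
    refine Submodule.sum_mem _ fun i _ => ?_
    rw [← algebraMap_smul F (b.repr ⟨u, hu⟩ i) (b i : X)]
    exact Submodule.smul_mem _ _ (Submodule.subset_span ⟨i, rfl⟩)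
  have : FiniteDimensional F (Submodule.span F (Set.range fun i => (b i : X))) :=
    FiniteDimensional.span_of_finite F (Set.finite_range _)
  refine (Submodule.finrank_mono h).trans ?_
  exact (finrank_range_le_card _).trans (by simp)

end LinearAlgebra

/-! ### The `ℚ_p`-span of a number field in the product of its embeddings -/

section EmbeddingSpan

variable (p : ℕ) [Fact p.Prime] (K : Type*) [Field K]

/-- The `ℚ_p`-span of the image of `K` in the product of its embeddings in `ℂ_p`. -/
noncomputable def embeddingSpan : Submodule ℚ_[p] ((K →+* ℂ_[p]) → ℂ_[p]) :=
  Submodule.span ℚ_[p] (Set.range fun (x : K) (σ : K →+* ℂ_[p]) => σ x)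

variable {p K} in
theorem mem_embeddingSpan (x : K) : (fun σ : K →+* ℂ_[p] => σ x) ∈ embeddingSpan p K :=
  Submodule.subset_span ⟨x, rfl⟩

variable [NumberField K]

theorem embeddingSpan_le : embeddingSpan p K ≤ Submodule.span ℚ_[p]
    (Set.range fun i (σ : K →+* ℂ_[p]) => σ (Module.finBasis ℚ K i)) := by
  rw [embeddingSpan, Submodule.span_le]
  rintro _ ⟨x, rfl⟩
  have h : (fun σ : K →+* ℂ_[p] => σ x) = ∑ i, (((Module.finBasis ℚ K).repr x i : ℚ) : ℚ_[p]) •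
      fun σ : K →+* ℂ_[p] => σ (Module.finBasis ℚ K i) := by
    ext σ
    conv_lhs => rw [← (Module.finBasis ℚ K).sum_repr x]
    simp only [map_sum, Finset.sum_apply, Pi.smul_apply]
    refine Finset.sum_congr rfl fun i _ => ?_
    rw [Algebra.smul_def, Algebra.smul_def, map_mul, map_ratCast, eq_ratCast, map_ratCast]
  rw [SetLike.mem_coe]
  beta_reduce
  rw [h]
  exact Submodule.sum_mem _ fun i _ => Submodule.smul_mem _ _ (Submodule.subset_span ⟨i, rfl⟩)

instance : FiniteDimensional ℚ_[p] (embeddingSpan p K) :=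
  have := FiniteDimensional.span_of_finite ℚ_[p]
    (Set.finite_range fun i (σ : K →+* ℂ_[p]) => σ (Module.finBasis ℚ K i))
  Submodule.finiteDimensional_of_le (embeddingSpan_le p K)

theorem finrank_embeddingSpan_le :
    Module.finrank ℚ_[p] (embeddingSpan p K) ≤ Fintype.card (K →+* ℂ_[p]) := by
  have := FiniteDimensional.span_of_finite ℚ_[p]
    (Set.finite_range fun i (σ : K →+* ℂ_[p]) => σ (Module.finBasis ℚ K i))
  refine (Submodule.finrank_mono (embeddingSpan_le p K)).trans ?_
  rw [NumberField.Embeddings.card]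
  exact (finrank_range_le_card _).trans (by simp)

theorem isClosed_embeddingSpan : IsClosed (embeddingSpan p K : Set ((K →+* ℂ_[p]) → ℂ_[p])) :=
  Submodule.closed_of_finiteDimensional _

variable {p K}

/-- The logarithm is the limit of (y^(p^n) - 1)/p^n, which are elements of `K`, and a
finite-dimensional subspace is closed. -/
theorem padicLog_mem_embeddingSpan {y : K} (hy : ∀ σ : K →+* ℂ_[p], ‖σ y - 1‖ < 1) :
    (fun σ : K →+* ℂ_[p] => padicLog p (σ y)) ∈ embeddingSpan p K := by
  refine (isClosed_embeddingSpan p K).mem_of_tendsto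
    (f := fun (n : ℕ) (σ : K →+* ℂ_[p]) => σ ((y ^ p ^ n - 1) / (p : K) ^ n)) (b := atTop) ?_
    (Eventually.of_forall fun n => mem_embeddingSpan _)
  refine tendsto_pi_nhds.mpr fun σ => (tendsto_padicLog (hy σ)).congr fun n => ?_
  simp

/-- Restriction of functions to a subset. -/
noncomputable def restrictLinear (k F : Type*) [Field k] [Field F] [Algebra k F] {E : Type*}
    (T : Set E) : (E → F) →ₗ[k] (T → F) :=
  LinearMap.funLeft k F Subtype.val

-- Multiplication by 1 - e^(p^n) preserves the image of `K` and tends to the projection that kills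
-- the coordinates in `T`, so the span is stable under this projection.
open Classical in
theorem indicator_mem_embeddingSpan {T : Set (K →+* ℂ_[p])} {e : K} (h1 : ∀ σ ∈ T, ‖σ e - 1‖ < 1)
    (h0 : ∀ σ ∉ T, ‖σ e‖ < 1) {v : (K →+* ℂ_[p]) → ℂ_[p]} (hv : v ∈ embeddingSpan p K) :
    (fun σ => if σ ∈ T then 0 else v σ) ∈ embeddingSpan p K := by
  let φ : ((K →+* ℂ_[p]) → ℂ_[p]) →ₗ[ℚ_[p]] ((K →+* ℂ_[p]) → ℂ_[p]) :=
    LinearMap.pi fun σ => if σ ∈ T then 0 else LinearMap.proj σ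
  have hφ : ∀ w, φ w = fun σ => if σ ∈ T then 0 else w σ := fun w => by
    ext σ
    simp only [φ, LinearMap.pi_apply]
    split_ifs <;> simp
  suffices h : embeddingSpan p K ≤ (embeddingSpan p K).comap φ by
    have := h hv
    rwa [Submodule.mem_comap, hφ] at this
  conv_lhs => rw [embeddingSpan]
  rw [Submodule.span_le]
  rintro _ ⟨x, rfl⟩
  rw [SetLike.mem_coe, Submodule.mem_comap, hφ]
  have hpow : Tendsto (fun n => p ^ n) atTop atTop :=
    tendsto_pow_atTop_atTop_of_one_lt (Fact.out : p.Prime).one_lt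
  refine (isClosed_embeddingSpan p K).mem_of_tendsto
    (f := fun (n : ℕ) (σ : K →+* ℂ_[p]) => σ ((1 - e ^ p ^ n) * x)) (b := atTop) ?_
    (Eventually.of_forall fun n => mem_embeddingSpan _)
  refine tendsto_pi_nhds.mpr fun σ => ?_
  simp only [map_mul, map_sub, map_one, map_pow]
  by_cases hσ : σ ∈ T
  · have h := ((tendsto_pow_prime_pow norm_prime_complex_lt_one (h1 σ hσ)).const_sub 1).mul_const (σ x)
    simpa [hσ] using h
  · have h := (((tendsto_pow_atTop_nhds_zero_of_norm_lt_one (h0 σ hσ)).comp hpow).const_sub 1).mul_const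
      (σ x)
    simpa [hσ] using h

/-- A nonzero linear form vanishing on the image of `K` would be a linear relation between distinct
embeddings, against Dedekind's independence of characters. -/
theorem span_embeddings_eq_top (T : Set (K →+* ℂ_[p])) :
    Submodule.span ℂ_[p] (Set.range fun (x : K) (σ : T) => σ.1 x) = ⊤ := by
  classical
  by_contra h
  obtain ⟨f, hf, hle⟩ := Submodule.exists_le_ker_of_lt_top _ (lt_top_iff_ne_top.mpr h)
  apply hf
  have : Fintype T := Fintype.ofFinite T
  have hind : LinearIndependent ℂ_[p] fun σ : T => (σ.1 : K → ℂ_[p]) := by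
    have h1 := linearIndependent_monoidHom K ℂ_[p]
    refine h1.comp (fun σ : T => (σ.1 : K →* ℂ_[p])) fun a b hab => ?_
    ext x
    exact DFunLike.congr_fun hab x
  rw [Fintype.linearIndependent_iff] at hind
  have hz := hind (fun σ => f (Pi.single σ 1)) (by
    ext x
    have h2 : f (fun σ : T => σ.1 x) = 0 := hle (Submodule.subset_span ⟨x, rfl⟩)
    rw [LinearMap.pi_apply_eq_sum_univ] at h2
    simp only [Finset.sum_apply, Pi.smul_apply, smul_eq_mul, Pi.zero_apply] at h2 ⊢
    rw [← h2]
    refine Finset.sum_congr rfl fun σ _ => ?_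
    rw [mul_comm]
    congr 2
    ext j
    simp [Pi.single_apply, eq_comm])
  refine LinearMap.pi_ext' fun σ => LinearMap.ext_ring ?_
  simpa using hz σ

theorem ncard_le_finrank_restrict (T : Set (K →+* ℂ_[p])) :
    T.ncard ≤ Module.finrank ℚ_[p] ((embeddingSpan p K).map (restrictLinear ℚ_[p] ℂ_[p] T)) := by
  refine le_trans ?_ (finrank_span_le_finrank (F := ℂ_[p]) _)
  have h : Submodule.span ℂ_[p]
      ((embeddingSpan p K).map (restrictLinear ℚ_[p] ℂ_[p] T) : Set (T → ℂ_[p])) = ⊤ := by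
    rw [eq_top_iff, ← span_embeddings_eq_top, Submodule.span_le]
    rintro _ ⟨x, rfl⟩
    exact Submodule.subset_span ⟨_, mem_embeddingSpan x, rfl⟩
  have : Fintype T := Fintype.ofFinite T
  rw [h, finrank_top, Module.finrank_fintype_fun_eq_card, ← Nat.card_eq_fintype_card,
    Nat.card_coe_set_eq]

/-- If some element of `K` is close to `1` exactly at the embeddings in `T` and to `0` at the others,
then `K` spans a `ℚ_p`-space of dimension at most `|T|` in the product over `T`. -/
theorem finrank_restrict_embeddingSpan_le {T : Set (K →+* ℂ_[p])} {e : K}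
    (h1 : ∀ σ ∈ T, ‖σ e - 1‖ < 1) (h0 : ∀ σ ∉ T, ‖σ e‖ < 1) :
    Module.finrank ℚ_[p] ((embeddingSpan p K).map (restrictLinear ℚ_[p] ℂ_[p] T)) ≤ T.ncard := by
  classical
  set V := embeddingSpan p K
  let π := restrictLinear ℚ_[p] ℂ_[p] T
  let π' := restrictLinear ℚ_[p] ℂ_[p] Tᶜ
  have e1 := (π.domRestrict V).finrank_range_add_finrank_ker
  rw [LinearMap.range_domRestrict] at e1
  -- The vectors of `V` that vanish on `T` map onto the projection of `V` off `T`. So the dimensions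
  -- over `T` and `Tᶜ` add up to at most the number of embeddings, and the lower bound over `Tᶜ`
  -- becomes the upper bound over `T`.
  have e2 : Module.finrank ℚ_[p] (V.map π') ≤
      Module.finrank ℚ_[p] (LinearMap.ker (π.domRestrict V)) := by
    have h : V.map π' ≤ (LinearMap.ker (π.domRestrict V)).map (π'.domRestrict V) := by
      rintro _ ⟨v, hv, rfl⟩
      refine ⟨⟨_, indicator_mem_embeddingSpan h1 h0 hv⟩, ?_, ?_⟩
      · rw [SetLike.mem_coe, LinearMap.mem_ker]
        ext σ
        change (if (σ : K →+* ℂ_[p]) ∈ T then (0 : ℂ_[p]) else v σ) = 0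
        exact if_pos σ.2
      · ext σ
        change (if (σ : K →+* ℂ_[p]) ∈ T then (0 : ℂ_[p]) else v σ) = v σ
        exact if_neg σ.2
    exact (Submodule.finrank_mono h).trans (Submodule.finrank_map_le _ _)
  have e3 := ncard_le_finrank_restrict (p := p) (K := K) Tᶜ
  have e4 := finrank_embeddingSpan_le p K
  have e5 := Set.ncard_add_ncard_compl T
  rw [← Nat.card_eq_fintype_card] at e4
  change Module.finrank ℚ_[p] (V.map π) ≤ _
  change _ ≤ Module.finrank ℚ_[p] (V.map π') at e3
  change Module.finrank ℚ_[p] V ≤ _ at e4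
  omega

end EmbeddingSpan

/-! ### Linear independence modulo torsion -/

theorem linearIndependent_comp_of_ker_torsion {ι R A B : Type*} [CommRing R] [IsDomain R]
    [AddCommGroup A] [Module R A] [AddCommGroup B] [Module R B] {v : ι → A}
    (hv : LinearIndependent R v) (f : A →ₗ[R] B)
    (hf : ∀ a, f a = 0 → ∃ n : R, n ≠ 0 ∧ n • a = 0) : LinearIndependent R fun i => f (v i) := by
  rw [linearIndependent_iff'] at hv ⊢
  intro s c hc i hi
  obtain ⟨n, hn, h⟩ := hf (∑ i ∈ s, c i • v i) (by simpa using hc)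
  rw [Finset.smul_sum] at h
  simp_rw [smul_smul] at h
  exact (mul_eq_zero.mp (hv s _ h i hi)).resolve_left hn

theorem exists_smul_mem_span_of_card_eq_finrank {ι A : Type*} [Fintype ι] [AddCommGroup A]
    [Module.Finite ℤ A] {v : ι → A} (hcard : Fintype.card ι = Module.finrank ℤ A)
    (hv : LinearIndependent ℤ v) (a : A) :
    ∃ n : ℤ, n ≠ 0 ∧ n • a ∈ Submodule.span ℤ (Set.range v) := by
  have h2 := Submodule.finrank_quotient_add_finrank (Submodule.span ℤ (Set.range v))
  rw [finrank_span_eq_card hv, hcard] at h2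
  have h1 : Module.finrank ℤ (A ⧸ Submodule.span ℤ (Set.range v)) = 0 := by omega
  rw [Module.finrank_eq_zero_iff] at h1
  obtain ⟨n, hn, h⟩ := h1 (Submodule.Quotient.mk a)
  exact ⟨n, hn, by rwa [← Submodule.Quotient.mk_smul, Submodule.Quotient.mk_eq_zero] at h⟩

/-! ### The Galois group modulo a central involution -/

section Involution

variable {G : Type*} [Group G] {c : G}

theorem normal_zpowers_of_central (hc : ∀ g, c * g = g * c) : (Subgroup.zpowers c).Normal where
  conj_mem n hn g := by
    obtain ⟨k, rfl⟩ := hn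
    have h : g * c ^ k * g⁻¹ = c ^ k := by
      rw [← (Commute.zpow_left (show Commute c g from hc g) k).eq, mul_inv_cancel_right]
    exact ⟨k, h.symm⟩

theorem mk_zpowers_eq_iff (hc : ∀ g, c * g = g * c) (hcc : c * c = 1) {a b : G} :
    (a : G ⧸ Subgroup.zpowers c) = b ↔ b = a ∨ b = c * a := by
  rw [QuotientGroup.eq]
  have h : ∀ x, x ∈ Subgroup.zpowers c ↔ x = 1 ∨ x = c := by
    intro x
    constructor
    · rintro ⟨k, rfl⟩
      have h2 : c ^ (2 : ℤ) = 1 := by rw [zpow_two, hcc]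
      obtain ⟨m, rfl | rfl⟩ := Int.even_or_odd' k
      · left; simp [zpow_mul, h2]
      · right; simp [zpow_add, zpow_mul, h2]
    · rintro (rfl | rfl)
      · exact one_mem _
      · exact Subgroup.mem_zpowers _
  rw [h, inv_mul_eq_one, inv_mul_eq_iff_eq_mul, hc]
  tauto

theorem apply_out_mk (hc : ∀ g, c * g = g * c) (hcc : c * c = 1) {B : Type*} {f : G → B}
    (hf : ∀ g, f (c * g) = f g) (g : G) : f ((g : G ⧸ Subgroup.zpowers c).out) = f g := by
  rcases (mk_zpowers_eq_iff hc hcc (a := g) (b := (g : G ⧸ Subgroup.zpowers c).out)).mp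
    (QuotientGroup.out_eq' _).symm with h | h
  · rw [h]
  · rw [h, hf]

theorem sum_eq_two_nsmul_sum_out [Finite G] (hc : ∀ g, c * g = g * c) (hcc : c * c = 1)
    (hc1 : c ≠ 1) {B : Type*} [AddCommMonoid B] {f : G → B} (hf : ∀ g, f (c * g) = f g) :
    ∑ᶠ g, f g = 2 • ∑ᶠ x : G ⧸ Subgroup.zpowers c, f x.out := by
  classical
  have := Fintype.ofFinite G
  rw [finsum_eq_sum_of_fintype, finsum_eq_sum_of_fintype,
    ← Finset.sum_fiberwise _ (fun g : G => (g : G ⧸ Subgroup.zpowers c)), Finset.smul_sum]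
  refine Finset.sum_congr rfl fun x _ => ?_
  have h : (Finset.univ.filter fun g : G => (g : G ⧸ Subgroup.zpowers c) = x) = {x.out, c * x.out} := by
    ext g
    have := mk_zpowers_eq_iff hc hcc (a := x.out) (b := g)
    rw [QuotientGroup.out_eq'] at this
    simp only [Finset.mem_filter, Finset.mem_univ, true_and, Finset.mem_insert,
      Finset.mem_singleton]
    rw [← this, eq_comm]
  rw [h, Finset.sum_pair, hf, two_nsmul]
  intro h
  exact hc1 (mul_eq_right.mp h.symm)

/-- The sum over the group is twice the sum over the classes. -/
theorem sum_out_eq_zero [Finite G] (hc : ∀ g, c * g = g * c) (hcc : c * c = 1) (hc1 : c ≠ 1)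
    {B : Type*} [AddCommGroup B] (hB : ∀ b : B, 2 • b = 0 → b = 0) {f : G → B}
    (hf : ∀ g, f (c * g) = f g) (hsum : ∑ᶠ g, f g = 0) : ∑ᶠ x : G ⧸ Subgroup.zpowers c, f x.out = 0 := by
  rw [sum_eq_two_nsmul_sum_out hc hcc hc1 hf] at hsum
  exact hB _ hsum

/-- The number of cosets contained in `J` is the number of classes that do not meet `Jᶜ`. -/
theorem ncard_cosets_subset (hc : ∀ g, c * g = g * c) (hcc : c * c = 1) (J : Set G) :
    {A : Set G | (∃ g, A = {g, c * g}) ∧ A ⊆ J}.ncard =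
      ((fun g : G => (g : G ⧸ Subgroup.zpowers c)) '' Jᶜ)ᶜ.ncard := by
  let π := fun g : G => (g : G ⧸ Subgroup.zpowers c)
  have hfib : ∀ g : G, ({g, c * g} : Set G) = π ⁻¹' {π g} := by
    intro g
    ext h
    rw [Set.mem_preimage, Set.mem_singleton_iff, eq_comm, mk_zpowers_eq_iff hc hcc]
    rfl
  have hinj : Function.Injective fun x => π ⁻¹' {x} := by
    intro x y hxy
    obtain ⟨g, rfl⟩ := QuotientGroup.mk_surjective x
    have : g ∈ π ⁻¹' {y} := (Set.ext_iff.mp hxy g).mp rfl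
    exact this
  have : {A : Set G | (∃ g, A = {g, c * g}) ∧ A ⊆ J} = (fun x => π ⁻¹' {x}) '' (π '' Jᶜ)ᶜ := by
    ext A
    constructor
    · rintro ⟨⟨g, rfl⟩, hA⟩
      refine ⟨π g, ?_, (hfib g).symm⟩
      rintro ⟨h, hh, he⟩
      rw [hfib g] at hA
      exact hh (hA he)
    · rintro ⟨x, hx, rfl⟩
      obtain ⟨g, rfl⟩ := QuotientGroup.mk_surjective x
      refine ⟨⟨g, (hfib g).symm⟩, fun h hh => ?_⟩
      by_contra hJ
      exact hx ⟨h, hJ, hh⟩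
  rw [this, Set.ncard_image_of_injective _ hinj]

end Involution

/-! ### Complex conjugation -/

section Conj

variable {M : Type*} [Field M] [NumberField M] [NumberField.IsCMField M] {c : M ≃ₐ[ℚ] M}

theorem IsInducedByConj.apply_eq (hc : IsInducedByConj c) (x : M) :
    c x = IsCMField.complexConj M x := by
  obtain ⟨τ, hτ⟩ := hc
  apply τ.injective
  rw [IsCMField.complexEmbedding_complexConj, ← RCLike.star_def, ← hτ.eq]

theorem existsUnique_isInducedByConj : ∃! c : M ≃ₐ[ℚ] M, IsInducedByConj c := by
  obtain ⟨τ⟩ : Nonempty (M →+* ℂ) := inferInstance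
  refine ⟨(IsCMField.complexConj M).restrictScalars ℚ, ⟨τ, ?_⟩, fun d hd => ?_⟩
  · exact RingHom.ext fun x => (IsCMField.complexEmbedding_complexConj M τ x).symm
  · exact AlgEquiv.ext hd.apply_eq

theorem IsInducedByConj.embedding_apply (hc : IsInducedByConj c) (τ : M →+* ℂ) (x : M) :
    τ (c x) = star (τ x) := by
  rw [hc.apply_eq, IsCMField.complexEmbedding_complexConj, RCLike.star_def]

/-- Both τ and τ ∘ g are complex embeddings, and `c` induces conjugation through each of them. -/
theorem IsInducedByConj.central (hc : IsInducedByConj c) (g : M ≃ₐ[ℚ] M) : c * g = g * c := by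
  obtain ⟨τ⟩ : Nonempty (M →+* ℂ) := inferInstance
  ext x
  apply τ.injective
  change τ (c (g x)) = (τ.comp (g : M →+* M)) (c x)
  rw [hc.embedding_apply, hc.embedding_apply]
  rfl

theorem IsInducedByConj.mul_self (hc : IsInducedByConj c) : c * c = 1 := by
  ext x
  change c (c x) = x
  rw [hc.apply_eq, hc.apply_eq, IsCMField.complexConj_apply_apply]

theorem IsInducedByConj.ne_one (hc : IsInducedByConj c) : c ≠ 1 := by
  rintro rfl
  refine IsCMField.complexConj_ne_one M (AlgEquiv.ext fun x => ?_)
  rw [← hc.apply_eq]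
  rfl

/-- `M` is totally complex, so |G| is twice the number r + 1 of infinite places, and ⟨c⟩ has order
2. -/
theorem IsInducedByConj.card_quotient [IsGalois ℚ M] (hc : IsInducedByConj c) :
    Nat.card ((M ≃ₐ[ℚ] M) ⧸ Subgroup.zpowers c) = Units.rank M + 1 := by
  have h1 := Subgroup.card_eq_card_quotient_mul_card_subgroup (Subgroup.zpowers c)
  have h2 : orderOf c = 2 := orderOf_eq_prime (by rw [sq, hc.mul_self]) hc.ne_one
  rw [Nat.card_zpowers, h2, IsGalois.card_aut_eq_finrank,
    IsTotallyComplex.finrank] at h1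
  have h3 := InfinitePlace.card_eq_nrRealPlaces_add_nrComplexPlaces M
  rw [IsTotallyComplex.nrRealPlaces_eq_zero] at h3
  have h4 : 0 < Fintype.card (InfinitePlace M) := Fintype.card_pos
  rw [Units.rank]
  omega

end Conj

/-! ### Galois conjugates of units -/

section GalUnit

variable {M : Type*} [Field M]

theorem unit_ext {u v : (𝓞 M)ˣ} (h : ((u : 𝓞 M) : M) = ((v : 𝓞 M) : M)) : u = v :=
  Units.ext (RingOfIntegers.ext h)

/-- The class of a unit modulo torsion, written additively. -/
noncomputable abbrev unitClass : Additive (𝓞 M)ˣ →ₗ[ℤ]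
    Additive (𝓞 M)ˣ ⧸ Submodule.torsion ℤ (Additive (𝓞 M)ˣ) :=
  (Submodule.torsion ℤ (Additive (𝓞 M)ˣ)).mkQ

theorem exists_zsmul_eq_zero_of_unitClass_eq_zero (a : Additive (𝓞 M)ˣ) (ha : unitClass a = 0) :
    ∃ n : ℤ, n ≠ 0 ∧ n • a = 0 := by
  rw [Submodule.mkQ_apply, Submodule.Quotient.mk_eq_zero, Submodule.mem_torsion_iff] at ha
  obtain ⟨n, hn⟩ := ha
  exact ⟨n, nonZeroDivisors.ne_zero n.2, hn⟩

theorem eq_zero_of_nsmul_eq_zero {n : ℕ} (hn : n ≠ 0)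
    {b : Additive (𝓞 M)ˣ ⧸ Submodule.torsion ℤ (Additive (𝓞 M)ˣ)} (hb : n • b = 0) : b = 0 := by
  obtain ⟨a, rfl⟩ := Submodule.mkQ_surjective _ b
  rw [← map_nsmul] at hb
  obtain ⟨m, hm, h⟩ := exists_zsmul_eq_zero_of_unitClass_eq_zero _ hb
  rw [Submodule.mkQ_apply, Submodule.Quotient.mk_eq_zero, Submodule.mem_torsion_iff]
  refine ⟨⟨m * n, mem_nonZeroDivisors_of_ne_zero (mul_ne_zero hm (by exact_mod_cast hn))⟩, ?_⟩
  rw [Submonoid.mk_smul, mul_smul, natCast_zsmul, h]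

theorem unitClass_eq_zero_of_mem_torsion {u : (𝓞 M)ˣ} (hu : u ∈ Units.torsion M) :
    unitClass (Additive.ofMul u) = 0 := by
  rw [Units.torsion, CommGroup.mem_torsion, isOfFinOrder_iff_pow_eq_one] at hu
  obtain ⟨n, hn, h⟩ := hu
  rw [Submodule.mkQ_apply, Submodule.Quotient.mk_eq_zero, Submodule.mem_torsion_iff]
  refine ⟨⟨n, mem_nonZeroDivisors_of_ne_zero (by exact_mod_cast hn.ne')⟩, ?_⟩
  rw [Submonoid.mk_smul, natCast_zsmul]
  exact h

theorem finrank_unitClass [NumberField M] : Module.finrank ℤ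
    (Additive (𝓞 M)ˣ ⧸ Submodule.torsion ℤ (Additive (𝓞 M)ˣ)) = Units.rank M := by
  have h := Submodule.finrank_quotient_add_finrank (Submodule.torsion ℤ (Additive (𝓞 M)ˣ))
  have h0 : Module.finrank ℤ (Submodule.torsion ℤ (Additive (𝓞 M)ˣ)) = 0 := by
    rw [Module.finrank_eq_zero_iff]
    rintro ⟨a, ha⟩
    obtain ⟨n, hn⟩ := (Submodule.mem_torsion_iff a).mp ha
    exact ⟨n, nonZeroDivisors.ne_zero n.2, Subtype.ext hn⟩
  rw [h0, add_zero] at h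
  rw [h, Units.finrank_eq]

variable [CharZero M]

/-- The action of an automorphism on the units. -/
noncomputable abbrev galUnit (g : M ≃ₐ[ℚ] M) : (𝓞 M)ˣ →* (𝓞 M)ˣ :=
  Units.map (RingOfIntegers.mapRingHom (g : M →+* M) : 𝓞 M →* 𝓞 M)

theorem galUnit_mul (g h : M ≃ₐ[ℚ] M) (u : (𝓞 M)ˣ) : galUnit (g * h) u = galUnit g (galUnit h u) :=
  unit_ext rfl

variable [NumberField M]

/-- In a CM field a unit divided by its conjugate is a root of unity. -/
theorem unitClass_galUnit_conj [NumberField.IsCMField M] {c : M ≃ₐ[ℚ] M} (hc : IsInducedByConj c)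
    (u : (𝓞 M)ˣ) :
    unitClass (Additive.ofMul (galUnit c u)) = unitClass (Additive.ofMul u) := by
  have h : galUnit c u = IsCMField.unitsComplexConj M u := unit_ext (hc.apply_eq _)
  rw [h, eq_comm, ← sub_eq_zero, ← map_sub, ← ofMul_div, div_eq_mul_inv,
    ← IsCMField.unitsMulComplexConjInv_apply]
  exact unitClass_eq_zero_of_mem_torsion (Subtype.property _)

/-- The product of the conjugates is the norm, which is ±1. -/
theorem sum_unitClass_galUnit [IsGalois ℚ M] (u : (𝓞 M)ˣ) :
    ∑ᶠ g : M ≃ₐ[ℚ] M, unitClass (Additive.ofMul (galUnit g u)) = 0 := by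
  rw [finsum_eq_sum_of_fintype, ← map_sum, ← ofMul_prod]
  refine unitClass_eq_zero_of_mem_torsion ?_
  rw [Units.torsion, CommGroup.mem_torsion, isOfFinOrder_iff_pow_eq_one]
  refine ⟨2, two_pos, unit_ext ?_⟩
  have h1 : (((∏ g : M ≃ₐ[ℚ] M, galUnit g u : (𝓞 M)ˣ) : 𝓞 M) : M) =
      algebraMap ℚ M (Algebra.norm ℚ ((u : 𝓞 M) : M)) := by
    rw [Algebra.norm_eq_prod_automorphisms]
    simp
  have h2 : Algebra.norm ℚ ((u : 𝓞 M) : M) ^ 2 = 1 := by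
    rw [← sq_abs, Units.norm, one_pow]
  have h3 := congrArg (algebraMap ℚ M) h2
  rw [map_pow, map_one, ← h1] at h3
  simpa using h3

end GalUnit

/-! ### Global units in the disc of convergence -/

section DiscUnits

variable (p : ℕ) [Fact p.Prime] (M : Type*) [Field M]

/-- The units all of whose embeddings into `ℂ_p` lie in the open disc around `1`. -/
def discUnits : Subgroup (𝓞 M)ˣ where
  carrier := {u | ∀ σ : M →+* ℂ_[p], ‖σ ((u : 𝓞 M) : M) - 1‖ < 1}
  one_mem' σ := by simp
  mul_mem' {u v} hu hv σ := by
    simpa using norm_mul_sub_one_lt (hu σ) (hv σ)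
  inv_mem' {u} hu σ := by
    have h := (norm_zpow_sub_one_le (hu σ) (-1)).trans_lt (hu σ)
    rw [zpow_neg_one, ← map_inv₀] at h
    simpa using h

variable {p M}

/-- The logarithm of the image of a unit under an embedding. -/
noncomputable def logHom (σ : M →+* ℂ_[p]) : Additive (discUnits p M) →+ ℂ_[p] where
  toFun u := padicLog p (σ (((u.toMul : (𝓞 M)ˣ) : 𝓞 M) : M))
  map_zero' := by simpa using padicLog_one
  map_add' u v := by simpa using padicLog_mul (u.toMul.2 σ) (v.toMul.2 σ)

theorem exists_zsmul_eq_zero_of_logHom_eq_zero (σ : M →+* ℂ_[p]) (u : Additive (discUnits p M))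
    (hu : logHom σ u = 0) : ∃ n : ℤ, n ≠ 0 ∧ n • u = 0 := by
  obtain ⟨n, hn⟩ := exists_pow_prime_pow_eq_one_of_padicLog_eq_zero (u.toMul.2 σ) hu
  refine ⟨(p ^ n : ℕ), by exact_mod_cast pow_ne_zero _ (Fact.out : p.Prime).ne_zero, ?_⟩
  rw [← map_pow, ← map_one σ] at hn
  apply Additive.toMul.injective
  refine Subtype.ext (unit_ext ?_)
  have h2 := σ.injective hn
  rw [natCast_zsmul]
  simpa using h2

/-- The logarithm ignores torsion because ℂ_p has no additive torsion. Relations modulo torsion thus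
become relations between logarithms. -/
theorem logHom_eq_of_unitClass_eq (σ : M →+* ℂ_[p]) {u v : (𝓞 M)ˣ} (hu : u ∈ discUnits p M)
    (hv : v ∈ discUnits p M)
    (h : unitClass (Additive.ofMul u) = unitClass (Additive.ofMul v)) :
    padicLog p (σ ((u : 𝓞 M) : M)) = padicLog p (σ ((v : 𝓞 M) : M)) := by
  have h1 : unitClass (Additive.ofMul u - Additive.ofMul v) = 0 := by
    rw [map_sub, h, sub_self]
  obtain ⟨n, hn, h2⟩ := exists_zsmul_eq_zero_of_unitClass_eq_zero _ h1
  have h3 : n • (Additive.ofMul (⟨u, hu⟩ : discUnits p M) - Additive.ofMul ⟨v, hv⟩) = 0 := by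
    apply Additive.toMul.injective
    exact Subtype.ext h2
  have h4 := congrArg (logHom σ) h3
  rw [map_zsmul, map_sub, map_zero, smul_eq_zero, or_iff_right hn, sub_eq_zero] at h4
  exact h4

variable [NumberField M]

theorem galUnit_mem_discUnits {u : (𝓞 M)ˣ} (hu : u ∈ discUnits p M) (g : M ≃ₐ[ℚ] M) :
    galUnit g u ∈ discUnits p M := fun σ => hu (σ.comp (g : M →+* M))

theorem sum_padicLog_galUnit [IsGalois ℚ M] {u : (𝓞 M)ˣ} (hu : u ∈ discUnits p M)
    (σ : M →+* ℂ_[p]) : ∑ᶠ g : M ≃ₐ[ℚ] M, padicLog p (σ (g ((u : 𝓞 M) : M))) = 0 := by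
  have h := sum_unitClass_galUnit u
  rw [finsum_eq_sum_of_fintype] at h ⊢
  rw [← map_sum, ← ofMul_prod, ← map_zero unitClass, ← ofMul_one] at h
  have h1 := logHom_eq_of_unitClass_eq σ
    (Subgroup.prod_mem _ fun g _ => galUnit_mem_discUnits hu g) (Subgroup.one_mem _) h
  have h2 := map_sum (logHom σ)
    (fun g : M ≃ₐ[ℚ] M => Additive.ofMul ⟨galUnit g u, galUnit_mem_discUnits hu g⟩) Finset.univ
  refine h2.symm.trans (Eq.trans ?_ (h1.trans (by simpa using padicLog_one)))
  change padicLog p (σ _) = _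
  congr 3
  simp [← ofMul_prod]

end DiscUnits

/-! ### Independent conjugates -/

section Minkowski

variable {M : Type*} [Field M] [NumberField M] {c : M ≃ₐ[ℚ] M}

/-- The conjugates of `ε` by non-trivial representatives modulo `c` are independent modulo
torsion. -/
def HasIndependentConjugates (c : M ≃ₐ[ℚ] M) (ε : (𝓞 M)ˣ) : Prop :=
  LinearIndependent ℤ fun x : {x : (M ≃ₐ[ℚ] M) ⧸ Subgroup.zpowers c // x ≠ (1 : M ≃ₐ[ℚ] M)} =>
    unitClass (Additive.ofMul (galUnit x.1.out ε))

theorem HasIndependentConjugates.pow {ε : (𝓞 M)ˣ} (h : HasIndependentConjugates c ε) {n : ℕ}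
    (hn : n ≠ 0) : HasIndependentConjugates c (ε ^ n) := by
  have h1 := linearIndependent_comp_of_ker_torsion h ((n : ℤ) • LinearMap.id)
    fun a ha => ⟨n, Nat.cast_ne_zero.mpr hn, ha⟩
  have e : ∀ g : M ≃ₐ[ℚ] M, unitClass (Additive.ofMul (galUnit g (ε ^ n))) =
      ((n : ℤ) • LinearMap.id : _ →ₗ[ℤ] _) (unitClass (Additive.ofMul (galUnit g ε))) := fun g => by
    rw [map_pow, ofMul_pow, map_nsmul, LinearMap.smul_apply, natCast_zsmul, LinearMap.id_apply]
  rw [HasIndependentConjugates]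
  simp_rw [e]
  exact h1

variable [NumberField.IsCMField M]

theorem unitClass_galUnit_out (hc : IsInducedByConj c) (ε : (𝓞 M)ˣ) (g : M ≃ₐ[ℚ] M) :
    unitClass (Additive.ofMul (galUnit (g : (M ≃ₐ[ℚ] M) ⧸ Subgroup.zpowers c).out ε)) =
      unitClass (Additive.ofMul (galUnit g ε)) :=
  apply_out_mk hc.central hc.mul_self (f := fun g => unitClass (Additive.ofMul (galUnit g ε)))
    (fun g => by rw [galUnit_mul, unitClass_galUnit_conj hc]) g

variable [IsGalois ℚ M]

theorem card_ne_one (hc : IsInducedByConj c) :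
    Nat.card {x : (M ≃ₐ[ℚ] M) ⧸ Subgroup.zpowers c // x ≠ (1 : M ≃ₐ[ℚ] M)} = Units.rank M := by
  classical
  have := Fintype.ofFinite ((M ≃ₐ[ℚ] M) ⧸ Subgroup.zpowers c)
  have h := hc.card_quotient
  rw [Nat.card_eq_fintype_card] at h ⊢
  have h2 := Fintype.card_subtype_compl
    fun x : (M ≃ₐ[ℚ] M) ⧸ Subgroup.zpowers c => x = (1 : M ≃ₐ[ℚ] M)
  rw [Fintype.card_subtype_eq, h, Nat.add_sub_cancel] at h2
  exact h2

theorem sum_unitClass_galUnit_out (hc : IsInducedByConj c) (ε : (𝓞 M)ˣ) :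
    ∑ᶠ x : (M ≃ₐ[ℚ] M) ⧸ Subgroup.zpowers c,
      unitClass (Additive.ofMul (galUnit x.out ε)) = 0 := by
  exact sum_out_eq_zero hc.central hc.mul_self hc.ne_one
    (fun _ => eq_zero_of_nsmul_eq_zero two_ne_zero)
    (f := fun g => unitClass (Additive.ofMul (galUnit g ε)))
    (fun g => by rw [galUnit_mul, unitClass_galUnit_conj hc]) (sum_unitClass_galUnit ε)

/-- The r conjugates in question generate a finite-index subgroup of a group of rank r, which leaves
no room for a relation. -/
theorem IsWeakMinkowskiUnit.hasIndependentConjugates (hc : IsInducedByConj c) {ε : (𝓞 M)ˣ}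
    (hε : IsWeakMinkowskiUnit ε) : HasIndependentConjugates c ε := by
  classical
  have := Fintype.ofFinite ((M ≃ₐ[ℚ] M) ⧸ Subgroup.zpowers c)
  set v := fun x : {x : (M ≃ₐ[ℚ] M) ⧸ Subgroup.zpowers c // x ≠ (1 : M ≃ₐ[ℚ] M)} =>
    unitClass (Additive.ofMul (galUnit x.1.out ε)) with hv
  have hgen : ∀ g, unitClass (Additive.ofMul (galUnit g ε)) ∈ Submodule.span ℤ (Set.range v) := by
    intro g
    rw [← unitClass_galUnit_out hc]
    -- The conjugate left out, at the class of 1, is minus the sum of the others.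
    by_cases hg : (g : (M ≃ₐ[ℚ] M) ⧸ Subgroup.zpowers c) = (1 : M ≃ₐ[ℚ] M)
    · have h := sum_unitClass_galUnit_out hc ε
      rw [finsum_eq_sum_of_fintype, ← Finset.add_sum_erase _ _
        (Finset.mem_univ ((g : (M ≃ₐ[ℚ] M) ⧸ Subgroup.zpowers c))), add_eq_zero_iff_eq_neg] at h
      rw [h]
      refine Submodule.neg_mem _ (Submodule.sum_mem _ fun x hx => Submodule.subset_span ?_)
      exact ⟨⟨x, fun h => Finset.ne_of_mem_erase hx (h.trans hg.symm)⟩, rfl⟩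
    · exact Submodule.subset_span ⟨⟨_, hg⟩, rfl⟩
  refine linearIndependent_of_card_eq_finrank v ?_ fun a => ?_
  · rw [finrank_unitClass, ← card_ne_one hc, Nat.card_eq_fintype_card]
  · obtain ⟨u, rfl⟩ : ∃ u : (𝓞 M)ˣ, unitClass (Additive.ofMul u) = a := by
      obtain ⟨u, hu⟩ := Submodule.mkQ_surjective _ a
      exact ⟨u, hu⟩
    set C := Subgroup.closure (Set.range fun g : M ≃ₐ[ℚ] M => galUnit g ε) with hC
    have hfin : C.FiniteIndex := hε
    refine ⟨C.index, by exact_mod_cast hfin.index_ne_zero, ?_⟩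
    have h1 : ∀ w ∈ C, unitClass (Additive.ofMul w) ∈ Submodule.span ℤ (Set.range v) := by
      intro w hw
      induction hw using Subgroup.closure_induction with
      | mem x hx =>
        obtain ⟨g, rfl⟩ := hx
        exact hgen g
      | one => exact Submodule.zero_mem _
      | mul x y _ _ hx hy => exact Submodule.add_mem _ hx hy
      | inv x _ hx => exact Submodule.neg_mem _ hx
    exact h1 _ (Subgroup.pow_index_mem C u)

end Minkowski

/-! ### The rank of the matrix of logarithms -/

section Rank

variable {p : ℕ} [Fact p.Prime] {M : Type*} [Field M] [NumberField M]
  {c : M ≃ₐ[ℚ] M}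

theorem exists_eq_comp [IsGalois ℚ M] (σ τ : M →+* ℂ_[p]) : ∃ g : M ≃ₐ[ℚ] M, τ = σ.comp (g : M →+* M) := by
  classical
  have hF := Fintype.ofFinite (M ≃ₐ[ℚ] M)
  have hinj : Function.Injective fun g : M ≃ₐ[ℚ] M => σ.comp (g : M →+* M) := fun g h hgh =>
    AlgEquiv.ext fun x => σ.injective (RingHom.congr_fun hgh x)
  have hb : Function.Bijective fun g : M ≃ₐ[ℚ] M => σ.comp (g : M →+* M) := by
    rw [Fintype.bijective_iff_injective_and_card]
    refine ⟨hinj, ?_⟩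
    rw [NumberField.Embeddings.card, ← Nat.card_eq_fintype_card, IsGalois.card_aut_eq_finrank]
  obtain ⟨g, hg⟩ := hb.2 τ
  exact ⟨g, hg.symm⟩

/-- Independence modulo torsion lifts to the disc units, survives the logarithm because its kernel
is torsion, and passes from ℤ to ℚ by clearing denominators. -/
theorem HasIndependentConjugates.linearIndependent_padicLog {ε : (𝓞 M)ˣ}
    (h : HasIndependentConjugates c ε) (hε : ε ∈ discUnits p M) (σ : M →+* ℂ_[p]) :
    LinearIndependent ℚ
      fun x : {x : (M ≃ₐ[ℚ] M) ⧸ Subgroup.zpowers c // x ≠ (1 : M ≃ₐ[ℚ] M)} =>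
        padicLog p (σ (x.1.out ((ε : 𝓞 M) : M))) := by
  have h1 : LinearIndependent ℤ
      fun x : {x : (M ≃ₐ[ℚ] M) ⧸ Subgroup.zpowers c // x ≠ (1 : M ≃ₐ[ℚ] M)} =>
        (Additive.ofMul ⟨galUnit x.1.out ε, galUnit_mem_discUnits hε _⟩ :
          Additive (discUnits p M)) :=
    LinearIndependent.of_comp
      (unitClass.comp (MonoidHom.toAdditive (discUnits p M).subtype).toIntLinearMap) h
  have h2 := linearIndependent_comp_of_ker_torsion h1 (logHom σ).toIntLinearMap
    (exists_zsmul_eq_zero_of_logHom_eq_zero σ)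
  exact (LinearIndependent.iff_fractionRing ℤ ℚ).mp h2

theorem HasIndependentConjugates.algebraicIndependent_padicLog (hSp : PadicSchanuelConjecture p)
    {ε : (𝓞 M)ˣ} (h : HasIndependentConjugates c ε) (hε : ε ∈ discUnits p M) (σ : M →+* ℂ_[p]) :
    AlgebraicIndependent ℚ
      fun x : {x : (M ≃ₐ[ℚ] M) ⧸ Subgroup.zpowers c // x ≠ (1 : M ≃ₐ[ℚ] M)} =>
        padicLog p (σ (x.1.out ((ε : 𝓞 M) : M))) := by
  obtain ⟨n, ⟨e⟩⟩ := Finite.exists_equiv_fin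
    {x : (M ≃ₐ[ℚ] M) ⧸ Subgroup.zpowers c // x ≠ (1 : M ≃ₐ[ℚ] M)}
  refine (algebraicIndependent_equiv e.symm).mp ?_
  refine hSp n (fun i => σ ((e.symm i).1.out ((ε : 𝓞 M) : M))) (fun i => ?_) (fun i => ?_) ?_
  · simp
  · exact (Algebra.IsAlgebraic.isAlgebraic (R := ℚ) _).algHom σ.toRatAlgHom
  · exact (h.linearIndependent_padicLog hε σ).comp _ e.symm.injective

/-- The vector of logarithms of the conjugates of `ε` under `σ x`. -/
noncomputable def logRow (c : M ≃ₐ[ℚ] M) (ε : (𝓞 M)ˣ) (σ : M →+* ℂ_[p])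
    (x : (M ≃ₐ[ℚ] M) ⧸ Subgroup.zpowers c) (g : M ≃ₐ[ℚ] M) : ℂ_[p] :=
  padicLog p (σ (x.out (g ((ε : 𝓞 M) : M))))

variable [NumberField.IsCMField M]

theorem padicLog_galUnit_conj (hc : IsInducedByConj c) {ε : (𝓞 M)ˣ} (hε : ε ∈ discUnits p M)
    (σ : M →+* ℂ_[p]) (g : M ≃ₐ[ℚ] M) :
    padicLog p (σ ((c * g) ((ε : 𝓞 M) : M))) = padicLog p (σ (g ((ε : 𝓞 M) : M))) :=
  logHom_eq_of_unitClass_eq σ (galUnit_mem_discUnits hε (c * g)) (galUnit_mem_discUnits hε g)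
    (by rw [galUnit_mul, unitClass_galUnit_conj hc])

theorem padicLog_galUnit_out (hc : IsInducedByConj c) {ε : (𝓞 M)ˣ} (hε : ε ∈ discUnits p M)
    (σ : M →+* ℂ_[p]) (g : M ≃ₐ[ℚ] M) :
    padicLog p (σ ((g : (M ≃ₐ[ℚ] M) ⧸ Subgroup.zpowers c).out ((ε : 𝓞 M) : M))) =
      padicLog p (σ (g ((ε : 𝓞 M) : M))) :=
  apply_out_mk hc.central hc.mul_self (f := fun g => padicLog p (σ (g ((ε : 𝓞 M) : M))))
    (padicLog_galUnit_conj hc hε σ) g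

theorem sum_padicLog_galUnit_out [IsGalois ℚ M] (hc : IsInducedByConj c) {ε : (𝓞 M)ˣ}
    (hε : ε ∈ discUnits p M) (σ : M →+* ℂ_[p]) :
    ∑ᶠ x : (M ≃ₐ[ℚ] M) ⧸ Subgroup.zpowers c, padicLog p (σ (x.out ((ε : 𝓞 M) : M))) = 0 :=
  sum_out_eq_zero hc.central hc.mul_self hc.ne_one
    (fun _ hb => (smul_eq_zero.mp hb).resolve_left two_ne_zero)
    (f := fun g => padicLog p (σ (g ((ε : 𝓞 M) : M))))
    (padicLog_galUnit_conj hc hε σ) (sum_padicLog_galUnit hε σ)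

variable [IsGalois ℚ M]

theorem finrank_span_logRow (hSp : PadicSchanuelConjecture p) (hc : IsInducedByConj c)
    {ε : (𝓞 M)ˣ} (h : HasIndependentConjugates c ε) (hε : ε ∈ discUnits p M) (σ : M →+* ℂ_[p])
    (T : Set ((M ≃ₐ[ℚ] M) ⧸ Subgroup.zpowers c)) :
    Module.finrank ℂ_[p] (Submodule.span ℂ_[p] (logRow c ε σ '' T)) =
      min T.ncard (Units.rank M) := by
  classical
  have hN : (Subgroup.zpowers c).Normal := normal_zpowers_of_central hc.central
  have hF := Fintype.ofFinite ((M ≃ₐ[ℚ] M) ⧸ Subgroup.zpowers c)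
  have hcard := hc.card_quotient
  set L : (M ≃ₐ[ℚ] M) ⧸ Subgroup.zpowers c → ℂ_[p] :=
    fun x => padicLog p (σ (x.out ((ε : 𝓞 M) : M))) with hL
  -- The rows form the group matrix of `L`; invariance under `c` is used for `ε` and again for its
  -- conjugate by `g`.
  have hrow : ∀ (x : (M ≃ₐ[ℚ] M) ⧸ Subgroup.zpowers c) (g : M ≃ₐ[ℚ] M), logRow c ε σ x g = L (x * (g : (M ≃ₐ[ℚ] M) ⧸ Subgroup.zpowers c)) := by
    intro x g
    obtain ⟨y, rfl⟩ := QuotientGroup.mk_surjective x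
    rw [← QuotientGroup.mk_mul, hL]
    beta_reduce
    rw [padicLog_galUnit_out hc hε]
    exact padicLog_galUnit_out hc (galUnit_mem_discUnits hε g) σ y
  have hind : ∀ T : Set ((M ≃ₐ[ℚ] M) ⧸ Subgroup.zpowers c), T ≠ Set.univ →
      Module.finrank ℂ_[p] (Submodule.span ℂ_[p] (logRow c ε σ '' T)) = T.ncard := by
    intro T hT
    have h1 := linearIndependent_translates L (sum_padicLog_galUnit_out hc hε σ)
      (h.algebraicIndependent_padicLog hSp hε σ) hT
    -- Each column occurs once for every `g` in a class; pulling functions back along the surjection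
    -- to the quotient keeps independence.
    have h2 := h1.map' (LinearMap.funLeft ℂ_[p] ℂ_[p]
      (fun g : M ≃ₐ[ℚ] M => (g : (M ≃ₐ[ℚ] M) ⧸ Subgroup.zpowers c)))
      (LinearMap.ker_eq_bot.mpr (LinearMap.funLeft_injective_of_surjective _ _ _
        QuotientGroup.mk_surjective))
    have h3 : LinearIndependent ℂ_[p] fun x : T => logRow c ε σ x.1 := by
      have e : (fun x : T => logRow c ε σ x.1) = fun (x : T) (g : M ≃ₐ[ℚ] M) =>
          L (x * (g : (M ≃ₐ[ℚ] M) ⧸ Subgroup.zpowers c)) := by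
        ext x g
        exact hrow _ _
      rw [e]
      exact h2
    have : Fintype T := Fintype.ofFinite T
    have h4 := finrank_span_eq_card h3
    rw [Set.image_eq_range, h4, ← Nat.card_eq_fintype_card, Nat.card_coe_set_eq]
  have huniv : (Set.univ : Set ((M ≃ₐ[ℚ] M) ⧸ Subgroup.zpowers c)).ncard = Units.rank M + 1 := by
    rw [Set.ncard_univ, hcard]
  rcases eq_or_ne T Set.univ with rfl | hT
  -- All rows together sum to zero, so the row of 1 can be dropped.
  · have h0 : ({1}ᶜ : Set ((M ≃ₐ[ℚ] M) ⧸ Subgroup.zpowers c)) ≠ Set.univ := by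
      rw [Ne, Set.compl_univ_iff]
      exact Set.singleton_ne_empty 1
    have h1 : Submodule.span ℂ_[p] (logRow c ε σ '' Set.univ) =
        Submodule.span ℂ_[p] (logRow c ε σ '' ({1}ᶜ : Set ((M ≃ₐ[ℚ] M) ⧸ Subgroup.zpowers c))) := by
      refine le_antisymm (Submodule.span_le.mpr ?_)
        (Submodule.span_mono (Set.image_mono (Set.subset_univ _)))
      rintro _ ⟨x, -, rfl⟩
      by_cases hx : x = 1
      · have h2 : logRow c ε σ x =
            -∑ y ∈ Finset.univ.erase (1 : (M ≃ₐ[ℚ] M) ⧸ Subgroup.zpowers c), logRow c ε σ y := by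
          rw [eq_neg_iff_add_eq_zero, hx, Finset.add_sum_erase _ _ (Finset.mem_univ _)]
          ext g
          simp only [Finset.sum_apply, hrow, Pi.zero_apply]
          refine (Equiv.sum_comp (Equiv.mulRight (g : (M ≃ₐ[ℚ] M) ⧸ Subgroup.zpowers c)) L).trans ?_
          rw [← finsum_eq_sum_of_fintype]
          exact sum_padicLog_galUnit_out hc hε σ
        rw [SetLike.mem_coe, h2]
        exact Submodule.neg_mem _ (Submodule.sum_mem _ fun y hy =>
          Submodule.subset_span ⟨y, Finset.ne_of_mem_erase hy, rfl⟩)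
      · exact Submodule.subset_span ⟨x, hx, rfl⟩
    rw [h1, hind _ h0, huniv]
    have h2 := Set.ncard_add_ncard_compl ({1} : Set ((M ≃ₐ[ℚ] M) ⧸ Subgroup.zpowers c))
    rw [Set.ncard_singleton, hcard] at h2
    omega
  · rw [hind T hT]
    have h2 := Set.ncard_lt_ncard (Set.ssubset_univ_iff.mpr hT)
    omega

/-- The classes of the `g` with `σ g` in `S`. -/
def rowClasses (c : M ≃ₐ[ℚ] M) (S : Set (M →+* ℂ_[p])) (σ : M →+* ℂ_[p]) :
    Set ((M ≃ₐ[ℚ] M) ⧸ Subgroup.zpowers c) :=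
  (fun g : M ≃ₐ[ℚ] M => (g : (M ≃ₐ[ℚ] M) ⧸ Subgroup.zpowers c)) '' (complementJ S σ)ᶜ

/-- There are r + 1 - t classes, and min(r + 1 - t, r) = r - (t - 1)^+. -/
theorem min_ncard_rowClasses (hc : IsInducedByConj c) (S : Set (M →+* ℂ_[p])) (σ : M →+* ℂ_[p]) :
    ((min (rowClasses c S σ).ncard (Units.rank M) : ℕ) : ℤ) =
      (Module.finrank ℤ (Additive (𝓞 M)ˣ) : ℤ) -
        max ((cosetCount c (complementJ S σ) : ℤ) - 1) 0 := by
  have h1 : cosetCount c (complementJ S σ) = (rowClasses c S σ)ᶜ.ncard :=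
    ncard_cosets_subset hc.central hc.mul_self _
  have h2 := Set.ncard_add_ncard_compl (rowClasses c S σ)
  rw [hc.card_quotient] at h2
  rw [h1, Units.finrank_eq]
  omega

/-- Every embedding is σg for some `g`, and its row depends only on the class of `g`; the choice of
`σ` merely labels the rows. -/
theorem rank_padicLogMatrix_eq_min (hSp : PadicSchanuelConjecture p) (hc : IsInducedByConj c)
    {ε : (𝓞 M)ˣ} (h : HasIndependentConjugates c ε) (hε : ε ∈ discUnits p M)
    (S : Set (M →+* ℂ_[p])) (σ : M →+* ℂ_[p]) :
    (padicLogMatrix S ε).rank = min (rowClasses c S σ).ncard (Units.rank M) := by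
  rw [← finrank_span_logRow hSp hc h hε σ, Matrix.rank_eq_finrank_span_row]
  have h1 : Set.range (padicLogMatrix S ε).row = logRow c ε σ '' rowClasses c S σ := by
    have h2 : ∀ g : M ≃ₐ[ℚ] M, logRow c ε σ (g : (M ≃ₐ[ℚ] M) ⧸ Subgroup.zpowers c) =
        fun h : M ≃ₐ[ℚ] M => padicLog p (σ (g (h ((ε : 𝓞 M) : M)))) := fun g =>
      funext fun h => padicLog_galUnit_out hc (galUnit_mem_discUnits hε h) σ g
    ext v
    constructor
    · rintro ⟨⟨τ, hτ⟩, rfl⟩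
      obtain ⟨g, rfl⟩ := exists_eq_comp σ τ
      exact ⟨_, ⟨g, fun h => h hτ, rfl⟩, h2 g⟩
    · rintro ⟨_, ⟨g, hg, rfl⟩, rfl⟩
      exact ⟨⟨σ.comp (g : M →+* M), not_not.mp hg⟩, (h2 g).symm⟩
  rw [h1]

end Rank

/-! ### Existence of units with independent conjugates -/

section Existence

variable {M : Type*} [Field M]

/-- The logarithmic absolute value of a conjugate of a unit. -/
noncomputable def archLogHom (τ : M →+* ℂ) : Additive (𝓞 M)ˣ →+ ℝ where
  toFun u := Real.log ‖τ (((u.toMul : (𝓞 M)ˣ) : 𝓞 M) : M)‖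
  map_zero' := by simp
  map_add' u v := by
    simp only [toMul_add, Units.val_mul, map_mul, norm_mul]
    exact Real.log_mul (by simp) (by simp)

theorem archLogHom_eq_zero (τ : M →+* ℂ) {a : Additive (𝓞 M)ˣ} (ha : unitClass a = 0) :
    archLogHom τ a = 0 := by
  obtain ⟨n, hn, h⟩ := exists_zsmul_eq_zero_of_unitClass_eq_zero a ha
  have h1 := congrArg (archLogHom τ) h
  rw [map_zsmul, map_zero, smul_eq_zero] at h1
  exact h1.resolve_left hn

variable [NumberField M] [IsGalois ℚ M] [NumberField.IsCMField M] {c : M ≃ₐ[ℚ] M}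

/-- Dirichlet's construction gives a unit whose logarithm is negative at all places but one. The
rows of (L (x⁻¹ * y)), with y over all classes, sum to zero; deleting the negative column y = 1
leaves a strictly diagonally dominant, hence invertible, matrix. -/
theorem exists_hasIndependentConjugates (hc : IsInducedByConj c) :
    ∃ ε : (𝓞 M)ˣ, HasIndependentConjugates c ε := by
  classical
  have hN : (Subgroup.zpowers c).Normal := normal_zpowers_of_central hc.central
  have hF := Fintype.ofFinite ((M ≃ₐ[ℚ] M) ⧸ Subgroup.zpowers c)
  obtain ⟨τ⟩ : Nonempty (M →+* ℂ) := inferInstance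
  obtain ⟨u, hu⟩ := Units.dirichletUnitTheorem.exists_unit M (InfinitePlace.mk τ)
  let a : (M ≃ₐ[ℚ] M) → ℝ := fun g => archLogHom τ (Additive.ofMul (galUnit g u))
  have hac : ∀ g, a (c * g) = a g := fun g => by
    change Real.log ‖τ (c (g _))‖ = Real.log ‖τ (g _)‖
    rw [hc.embedding_apply, norm_star]
  have hneg : ∀ g : M ≃ₐ[ℚ] M, (g : (M ≃ₐ[ℚ] M) ⧸ Subgroup.zpowers c) ≠ 1 → a g < 0 := by
    intro g hg
    refine hu (InfinitePlace.mk (τ.comp (g : M →+* M))) fun h => hg ?_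
    rw [← QuotientGroup.mk_one, eq_comm, mk_zpowers_eq_iff hc.central hc.mul_self, mul_one]
    rcases InfinitePlace.mk_eq_iff.mp h.symm with h | h
    · exact Or.inl (AlgEquiv.ext fun x => τ.injective (RingHom.congr_fun h.symm x))
    · refine Or.inr (AlgEquiv.ext fun x => τ.injective ?_)
      rw [hc.embedding_apply]
      exact RingHom.congr_fun h.symm x
  let L : (M ≃ₐ[ℚ] M) ⧸ Subgroup.zpowers c → ℝ := fun x => a x.out
  have hL : ∀ g : M ≃ₐ[ℚ] M, L g = a g := apply_out_mk hc.central hc.mul_self hac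
  have hLneg : ∀ x, x ≠ 1 → L x < 0 := fun x hx => hneg _ (by rwa [QuotientGroup.out_eq'])
  have hsum : ∑ x, L x = 0 := by
    rw [← finsum_eq_sum_of_fintype]
    refine sum_out_eq_zero hc.central hc.mul_self hc.ne_one
      (fun _ hb => (smul_eq_zero.mp hb).resolve_left two_ne_zero) hac ?_
    have h := sum_unitClass_galUnit u
    rw [finsum_eq_sum_of_fintype, ← map_sum] at h
    rw [finsum_eq_sum_of_fintype, ← map_sum]
    exact archLogHom_eq_zero τ h
  let A : Matrix {x : (M ≃ₐ[ℚ] M) ⧸ Subgroup.zpowers c // x ≠ (1 : M ≃ₐ[ℚ] M)}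
    {x : (M ≃ₐ[ℚ] M) ⧸ Subgroup.zpowers c // x ≠ (1 : M ≃ₐ[ℚ] M)} ℝ :=
    Matrix.of fun x y => L (x.1⁻¹ * y.1)
  have hA : A.det ≠ 0 := by
    refine det_ne_zero_of_sum_row_lt_diag fun x => ?_
    have h1 : ∑ y, L (x.1⁻¹ * y) = 0 := (Equiv.sum_comp (Equiv.mulLeft x.1⁻¹) L).trans hsum
    have h2 : ∑ y ∈ Finset.univ.erase x, ‖A x y‖ =
        -∑ y ∈ (Finset.univ.erase (1 : (M ≃ₐ[ℚ] M) ⧸ Subgroup.zpowers c)).erase x.1,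
          L (x.1⁻¹ * y) := by
      rw [← Finset.sum_neg_distrib]
      refine Finset.sum_bij (fun y _ => y.1) (fun y hy => ?_) (fun y _ z _ h => Subtype.ext h)
        (fun y hy => ?_) fun y hy => ?_
      · exact Finset.mem_erase.mpr ⟨fun h => Finset.ne_of_mem_erase hy (Subtype.ext h),
          Finset.mem_erase.mpr ⟨y.2, Finset.mem_univ _⟩⟩
      · exact ⟨⟨y, Finset.ne_of_mem_erase (Finset.mem_of_mem_erase hy)⟩, Finset.mem_erase.mpr
          ⟨fun h => Finset.ne_of_mem_erase hy (congrArg Subtype.val h), Finset.mem_univ _⟩, rfl⟩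
      · refine abs_of_neg (hLneg _ fun h => Finset.ne_of_mem_erase hy (Subtype.ext ?_))
        exact (inv_mul_eq_one.mp h).symm
    have hx1 : x.1 ∈ Finset.univ.erase (1 : (M ≃ₐ[ℚ] M) ⧸ Subgroup.zpowers c) :=
      Finset.mem_erase.mpr ⟨x.2, Finset.mem_univ _⟩
    rw [← Finset.add_sum_erase _ _ (Finset.mem_univ 1), ← Finset.add_sum_erase _ _ hx1] at h1
    have h3 : L (x.1⁻¹ * 1) < 0 := hLneg _ fun h => x.2 (by simpa using h)
    rw [h2]
    refine lt_of_lt_of_le ?_ (le_abs_self _)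
    change _ < L (x.1⁻¹ * x.1)
    linarith
  refine ⟨u, ?_⟩
  rw [HasIndependentConjugates, Fintype.linearIndependent_iff]
  intro m hm
  have hz : A.mulVec (fun y => (m y : ℝ)) = 0 := by
    ext x
    simp_rw [← map_smul, ← map_sum] at hm
    -- Taking absolute values of the relation through τ ∘ x⁻¹ yields row `x` of `A`.
    have h1 := archLogHom_eq_zero (τ.comp ((x.1.out⁻¹ : M ≃ₐ[ℚ] M) : M →+* M)) hm
    rw [map_sum] at h1
    simp only [Matrix.mulVec, dotProduct, Pi.zero_apply]
    rw [← h1]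
    refine Finset.sum_congr rfl fun y _ => ?_
    rw [map_zsmul, zsmul_eq_mul, mul_comm]
    congr 1
    have h2 : x.1⁻¹ * y.1 = ((x.1.out⁻¹ * y.1.out : M ≃ₐ[ℚ] M) :
        (M ≃ₐ[ℚ] M) ⧸ Subgroup.zpowers c) := by
      rw [QuotientGroup.mk_mul, QuotientGroup.mk_inv, QuotientGroup.out_eq',
        QuotientGroup.out_eq']
    change L (x.1⁻¹ * y.1) = _
    rw [h2, hL]
    rfl
  intro y
  have h1 : (m y : ℝ) = 0 := congrFun (Matrix.eq_zero_of_mulVec_eq_zero hA hz) y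
  exact_mod_cast h1

end Existence

/-! ### Embeddings into `ℂ_p` and primes above `p` -/

section Primes

theorem primesAbove_ext {p : ℕ} {M : Type*} [Field M] [NumberField M] {v w : PrimesAbove p M} (h : v.1.asIdeal = w.1.asIdeal) : v = w :=
  Subtype.ext (HeightOneSpectrum.ext h)

variable {p : ℕ} [Fact p.Prime] {M : Type*} [Field M]

/-- The valuation ring of ℂ_p is integrally closed. -/
theorem norm_embedding_le_one (σ : M →+* ℂ_[p]) (x : 𝓞 M) : ‖σ (x : M)‖ ≤ 1 := by
  obtain ⟨f, hf, hx⟩ := x.isIntegral_coe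
  have h2 := (Valuation.integer.integers
    (NormedField.valuation (K := ℂ_[p]))).mem_of_integral (x := σ (x : M))
    ⟨f.map (Int.castRingHom (NormedField.valuation (K := ℂ_[p])).integer), hf.map _, by
      rw [Polynomial.eval₂_map]
      have h := congrArg σ hx
      rw [Polynomial.hom_eval₂, map_zero] at h
      exact (congrArg (fun φ : ℤ →+* ℂ_[p] => f.eval₂ φ (σ (x : M)))
        (RingHom.ext_int _ _)).trans h⟩
  exact_mod_cast h2

/-- The prime ideal of `𝓞 M` defined by an embedding of `M` into `ℂ_p`. -/
def embeddingIdeal (σ : M →+* ℂ_[p]) : Ideal (𝓞 M) where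
  carrier := {x | ‖σ (x : M)‖ < 1}
  zero_mem' := by simp
  add_mem' {x y} hx hy := by
    rw [Set.mem_ofPred_eq] at *
    change ‖σ ((x : M) + y)‖ < 1
    rw [map_add]
    exact (IsUltrametricDist.norm_add_le_max _ _).trans_lt (max_lt hx hy)
  smul_mem' x y hy := by
    rw [Set.mem_ofPred_eq] at *
    change ‖σ ((x : M) * y)‖ < 1
    rw [map_mul, norm_mul]
    exact mul_lt_one_of_nonneg_of_lt_one_right (norm_embedding_le_one σ x) (norm_nonneg _) hy

theorem mem_embeddingIdeal {σ : M →+* ℂ_[p]} {x : 𝓞 M} :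
    x ∈ embeddingIdeal σ ↔ ‖σ (x : M)‖ < 1 := Iff.rfl

theorem natCast_mem_embeddingIdeal (σ : M →+* ℂ_[p]) : (p : 𝓞 M) ∈ embeddingIdeal σ := by
  rw [mem_embeddingIdeal]
  simpa using norm_prime_complex_lt_one

instance isPrime_embeddingIdeal (σ : M →+* ℂ_[p]) : (embeddingIdeal σ).IsPrime where
  ne_top' h := by
    have := (Ideal.eq_top_iff_one _).mp h
    rw [mem_embeddingIdeal] at this
    simp at this
  mem_or_mem' {x y} h := by
    have h : ‖σ (x * y : M)‖ < 1 := by simpa [mem_embeddingIdeal] using h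
    rw [map_mul, norm_mul] at h
    by_contra! h1
    simp only [mem_embeddingIdeal, not_lt] at h1
    exact absurd h (not_lt.mpr (one_le_mul_of_one_le_of_one_le h1.1 h1.2))

variable [NumberField M]

/-- Take for n the order of (𝓞 M / p)ˣ: then p divides u^n - 1. -/
theorem exists_pow_mem_discUnits : ∃ n : ℕ, n ≠ 0 ∧ ∀ u : (𝓞 M)ˣ, u ^ n ∈ discUnits p M := by
  have hp0 : (p : 𝓞 M) ≠ 0 := Nat.cast_ne_zero.mpr (Fact.out : p.Prime).ne_zero
  have hI : Ideal.span {(p : 𝓞 M)} ≠ ⊥ := by simpa using hp0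
  have hfin : Finite (𝓞 M ⧸ Ideal.span {(p : 𝓞 M)}) := Ideal.finiteQuotientOfFreeOfNeBot _ hI
  refine ⟨Nat.card (𝓞 M ⧸ Ideal.span {(p : 𝓞 M)})ˣ, Nat.card_pos.ne', fun u σ => ?_⟩
  have h1 := congrArg Units.val (pow_card_eq_one' (x := Units.map (Ideal.Quotient.mk
    (Ideal.span {(p : 𝓞 M)}) : 𝓞 M →* 𝓞 M ⧸ Ideal.span {(p : 𝓞 M)}) u))
  have h2 : Ideal.Quotient.mk (Ideal.span {(p : 𝓞 M)})
      ((u ^ Nat.card (𝓞 M ⧸ Ideal.span {(p : 𝓞 M)})ˣ : (𝓞 M)ˣ) : 𝓞 M) =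
      Ideal.Quotient.mk _ 1 := by
    rw [Units.val_pow_eq_pow_val, map_pow, map_one]
    exact h1
  rw [Ideal.Quotient.mk_eq_mk_iff_sub_mem, Ideal.mem_span_singleton'] at h2
  obtain ⟨a, ha⟩ := h2
  have h3 := congrArg (fun x : 𝓞 M => σ (x : M)) ha
  simp only [map_mul, map_sub, map_one, map_natCast] at h3
  rw [← h3, norm_mul]
  exact mul_lt_one_of_nonneg_of_lt_one_right (norm_embedding_le_one σ a) (norm_nonneg _)
    norm_prime_complex_lt_one

/-- The prime above `p` defined by an embedding of `M` into `ℂ_p`. -/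
def embeddingPrime (σ : M →+* ℂ_[p]) : PrimesAbove p M :=
  ⟨⟨embeddingIdeal σ, isPrime_embeddingIdeal σ, fun h => by
    have h1 := natCast_mem_embeddingIdeal σ
    rw [h, Ideal.mem_bot] at h1
    exact (Nat.cast_ne_zero (R := 𝓞 M)).mpr (Fact.out : p.Prime).ne_zero h1⟩,
    natCast_mem_embeddingIdeal σ⟩

/-- A continuous homomorphism preserves topological nilpotence, so `v` is contained in the prime of
`σ`, and `v` is maximal. -/
theorem FactorsThroughCompletion.embeddingPrime_eq {v : PrimesAbove p M} {σ : M →+* ℂ_[p]}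
    (h : FactorsThroughCompletion v σ) : embeddingPrime σ = v := by
  obtain ⟨ι, hι, rfl⟩ := h
  refine primesAbove_ext (Ideal.IsMaximal.eq_of_le (v.1.isPrime.isMaximal v.1.ne_bot)
    (isPrime_embeddingIdeal _).ne_top fun x hx => ?_).symm
  have h1 := (FinitePlace.norm_lt_one_iff_mem M v.1 x).mpr hx
  have h2 := (hι.tendsto 0).comp (tendsto_pow_atTop_nhds_zero_of_norm_lt_one h1)
  rw [map_zero] at h2
  rw [mem_embeddingIdeal]
  have h3 : Tendsto (fun n : ℕ => (ι (algebraMap M (v.1.adicCompletion M) (x : M))) ^ n) atTop (𝓝 0) := by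
    refine h2.congr fun n => ?_
    exact map_pow ι _ n
  rwa [tendsto_pow_atTop_nhds_zero_iff_norm_lt_one] at h3

variable [IsGalois ℚ M]

/-- The Galois group is transitive on the primes above p. -/
theorem exists_embeddingPrime_eq (σ : M →+* ℂ_[p]) (v : PrimesAbove p M) :
    ∃ g : M ≃ₐ[ℚ] M, embeddingPrime (σ.comp (g : M →+* M)) = v := by
  have hlies : ∀ w : PrimesAbove p M, w.1.asIdeal.LiesOver (Ideal.span {(p : ℤ)}) := by
    intro w
    have hw := w.1.isPrime
    have hmax : (Ideal.span {(p : ℤ)}).IsMaximal :=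
      PrincipalIdealRing.isMaximal_of_irreducible (Nat.prime_iff_prime_int.mp Fact.out).irreducible
    refine ⟨hmax.eq_of_le (Ideal.IsPrime.ne_top inferInstance) ?_⟩
    rw [Ideal.span_singleton_le_iff_mem, Ideal.mem_comap]
    simpa using w.2
  have h1 := hlies v
  have h2 := hlies (embeddingPrime σ)
  have h3 := v.1.isPrime
  have h4 := (embeddingPrime σ).1.isPrime
  obtain ⟨g, hg⟩ := Ideal.exists_smul_eq_of_isGaloisGroup (Ideal.span {(p : ℤ)})
    (embeddingPrime σ).1.asIdeal v.1.asIdeal (M ≃ₐ[ℚ] M)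
  refine ⟨g⁻¹, primesAbove_ext ?_⟩
  rw [← hg]
  ext x
  rw [Ideal.mem_pointwise_smul_iff_inv_smul_mem]
  rfl

/-- The preimage of the prime of σ₀ under `g` is the prime of σ₀g. So the row set depends on `Γ`
alone, not on `v₀` or `σ₀`. -/
theorem mem_rowSet_iff {Γ : Set (PrimesAbove p M)} {v₀ : PrimesAbove p M} {σ₀ : M →+* ℂ_[p]}
    (h : FactorsThroughCompletion v₀ σ₀) (σ : M →+* ℂ_[p]) :
    σ ∈ rowSet Γ v₀ σ₀ ↔ embeddingPrime σ ∈ Γ := by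
  have h0 : ∀ g : M ≃ₐ[ℚ] M, (embeddingPrime (σ₀.comp (g : M →+* M))).1.asIdeal =
      v₀.1.asIdeal.comap (RingOfIntegers.mapRingHom (g : M →+* M)) := by
    intro g
    rw [← h.embeddingPrime_eq]
    rfl
  constructor
  · rintro ⟨g, rfl, v, hv, hvg⟩
    rw [← h0] at hvg
    rwa [← primesAbove_ext hvg]
  · intro hσ
    obtain ⟨g, rfl⟩ := exists_eq_comp σ₀ σ
    exact ⟨g, rfl, _, hσ, h0 g⟩

end Primes

/-! ### Extending embeddings to completions -/

section Completion

variable {p : ℕ} [Fact p.Prime] {M : Type*} [Field M] [NumberField M]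

theorem norm_embedding_le_one_of_valuation_le_one (σ : M →+* ℂ_[p]) {x : M}
    (hx : (embeddingPrime σ).1.valuation M x ≤ 1) : ‖σ x‖ ≤ 1 := by
  obtain ⟨n, d, h⟩ := (embeddingPrime σ).1.exists_primeCompl_mul_eq_of_integer x hx
  have h1 : 1 ≤ ‖σ ((d : 𝓞 M) : M)‖ := not_lt.mp fun h => d.2 h
  have h2 := norm_embedding_le_one σ n
  have h3 : ‖σ x‖ * ‖σ ((d : 𝓞 M) : M)‖ = ‖σ (n : M)‖ := by
    rw [← norm_mul, ← map_mul]
    exact congrArg (fun y => ‖σ y‖) h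
  nlinarith [norm_nonneg (σ x)]

/-- If x is smaller than p^N at the prime of `σ`, then x/p^N is integral there, so |σx| ≤ |p|^N.
This gives the continuity needed to extend `σ` to the completion. -/
theorem exists_norm_lt_imp_norm_embedding_lt (σ : M →+* ℂ_[p]) {ε : ℝ} (hε : 0 < ε) :
    ∃ δ > 0, ∀ x : M,
      ‖algebraMap M ((embeddingPrime σ).1.adicCompletion M) x‖ < δ → ‖σ x‖ < ε := by
  obtain ⟨N, hN⟩ := exists_pow_lt_of_lt_one hε (norm_prime_complex_lt_one (p := p))
  have hp0 : (p : M) ^ N ≠ 0 :=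
    pow_ne_zero _ (Nat.cast_ne_zero.mpr (Fact.out : p.Prime).ne_zero)
  refine ⟨‖algebraMap M ((embeddingPrime σ).1.adicCompletion M) ((p : M) ^ N)‖,
    norm_pos_iff.mpr ((map_ne_zero _).mpr hp0), fun x hx => ?_⟩
  have h1 : ‖algebraMap M ((embeddingPrime σ).1.adicCompletion M) (x / (p : M) ^ N)‖ ≤ 1 := by
    rw [map_div₀, norm_div]
    exact div_le_one_of_le₀ hx.le (norm_nonneg _)
  have h2 : (embeddingPrime σ).1.valuation M (x / (p : M) ^ N) ≤ 1 := by
    rw [← HeightOneSpectrum.valuedAdicCompletion_eq_valuation']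
    exact (Valued.toNormedField.norm_le_one_iff
      (L := (embeddingPrime σ).1.adicCompletion M)).mp h1
  have h3 := norm_embedding_le_one_of_valuation_le_one σ h2
  rw [map_div₀, norm_div, map_pow, map_natCast, norm_pow, div_le_one₀] at h3
  · exact h3.trans_lt hN
  · exact pow_pos (norm_pos_iff.mpr (Nat.cast_ne_zero.mpr (Fact.out : p.Prime).ne_zero)) _

theorem factorsThroughCompletion_embeddingPrime (σ : M →+* ℂ_[p]) :
    FactorsThroughCompletion (embeddingPrime σ) σ := by
  let i := algebraMap M ((embeddingPrime σ).1.adicCompletion M)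
  let e : M ≃+* i.range := RingEquiv.ofBijective i.rangeRestrict
    ⟨fun x y h => i.injective (congrArg Subtype.val h), i.rangeRestrict_surjective⟩
  let f : i.range →+* ℂ_[p] := σ.comp (e.symm : i.range →+* M)
  have hf : UniformContinuous f := by
    refine uniformContinuous_of_continuousAt_zero f ?_
    rw [Metric.continuousAt_iff]
    intro ε hε
    obtain ⟨δ, hδ, h⟩ := exists_norm_lt_imp_norm_embedding_lt σ hε
    refine ⟨δ, hδ, fun {y} hy => ?_⟩
    obtain ⟨x, rfl⟩ := e.surjective y
    rw [map_zero, dist_zero_right] at *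
    have h1 : f (e x) = σ x := congrArg σ (e.symm_apply_apply x)
    rw [h1]
    exact h x hy
  have hd : DenseRange (i.range.subtype) := by
    have h := (HeightOneSpectrum.denseRange_algebraMap M (embeddingPrime σ).1)
    rw [DenseRange] at h ⊢
    convert h using 1
    ext y
    simp [i]
  have hu : IsUniformInducing (i.range.subtype) := isUniformInducing_val _
  refine ⟨IsDenseInducing.extendRingHom hu hd hf,
    (uniformContinuous_uniformly_extend hu hd hf).continuous, ?_⟩
  ext x
  have h1 := (hu.isDenseInducing hd).extend_eq hf.continuous (e x)
  refine Eq.trans ?_ h1.symm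
  exact (congrArg σ (e.symm_apply_apply x)).symm

theorem norm_map_sub_one_lt {v : PrimesAbove p M} {ι : v.1.adicCompletion M →+* ℂ_[p]}
    (hι : Continuous ι) {x : v.1.adicCompletion M} (hx : ‖x - 1‖ < 1) : ‖ι x - 1‖ < 1 := by
  have h2 := (hι.tendsto 0).comp (tendsto_pow_atTop_nhds_zero_of_norm_lt_one hx)
  rw [map_zero] at h2
  have h3 : Tendsto (fun n : ℕ => (ι (x - 1)) ^ n) atTop (𝓝 0) :=
    h2.congr fun n => map_pow ι _ n
  rwa [tendsto_pow_atTop_nhds_zero_iff_norm_lt_one, map_sub, map_one] at h3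

end Completion

/-! ### Submodules over `ℤ_p` -/

section PadicModules

variable (p : ℕ) [Fact p.Prime]

theorem norm_le_iff_dvd {a : ℤ_[p]} (n : ℕ) : ‖a‖ ≤ (p : ℝ) ^ (-n : ℤ) ↔ (p : ℤ_[p]) ^ n ∣ a := by
  rw [PadicInt.norm_le_pow_iff_mem_span_pow, Ideal.mem_span_singleton]

variable {p} in
theorem tendsto_appr_self (a : ℤ_[p]) :
    Tendsto (fun n => ((a.appr n : ℤ) : ℤ_[p])) atTop (𝓝 a) := by
  have hp : 1 < (p : ℝ) := by exact_mod_cast (Fact.out : p.Prime).one_lt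
  rw [tendsto_iff_norm_sub_tendsto_zero]
  refine squeeze_zero (fun _ => norm_nonneg _) (fun n => ?_)
    (tendsto_pow_atTop_nhds_zero_of_lt_one (r := (p : ℝ)⁻¹) (by positivity) (inv_lt_one_of_one_lt₀ hp))
  rw [norm_sub_rev]
  refine ((norm_le_iff_dvd p n).mpr (dvd_sub_appr p a n)).trans_eq ?_
  rw [zpow_neg, zpow_natCast, inv_pow]

/-- For a = p^N b, the element a • u is a limit of integer multiples of p^N • u, which are uniformly
small; a closed neighbourhood keeps the limit. -/
theorem continuous_padicSMul {A : Type*} [AddCommGroup A] [TopologicalSpace A]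
    [IsTopologicalAddGroup A] [HasPadicMultiples p A] [T2Space A] (u : A) :
    Continuous fun a : ℤ_[p] => padicSMul p a u := by
  let := padicModule p (A := A)
  refine continuous_of_continuousAt_zero ((LinearMap.toSpanSingleton ℤ_[p] A u).toAddMonoidHom) ?_
  intro V hV
  rw [map_zero] at hV
  obtain ⟨V', hV', hclosed, hsub⟩ := exists_mem_nhds_isClosed_subset hV
  obtain ⟨W, hW, h⟩ := HasPadicMultiples.small_multiples (p := p) V' hV'
  obtain ⟨N, hN⟩ := ((HasPadicMultiples.tendsto_zero (p := p) u).eventually hW).exists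
  have hp : 0 < (p : ℝ) ^ (-N : ℤ) := zpow_pos (by exact_mod_cast (Fact.out : p.Prime).pos) _
  rw [mem_map]
  filter_upwards [Metric.closedBall_mem_nhds (0 : ℤ_[p]) hp] with a ha
  rw [mem_closedBall_zero_iff, norm_le_iff_dvd] at ha
  obtain ⟨b, rfl⟩ := ha
  refine hsub ?_
  have e : ((p : ℤ_[p]) ^ N * b) • u = b • (((p : ℤ) ^ N) • u) := by
    rw [mul_comm, mul_smul, ← Int.cast_smul_eq_zsmul ℤ_[p]]
    push_cast
    rfl
  change ((p : ℤ_[p]) ^ N * b) • u ∈ V'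
  rw [e]
  exact hclosed.mem_of_tendsto (tendsto_appr p b _) (Eventually.of_forall fun n => h _ hN _)

/-- The span is a continuous image of the compact space of coefficient vectors over ℤ_p. -/
theorem isClosed_span_padic {X : Type*} [AddCommGroup X] [TopologicalSpace X] [T2Space X]
    [ContinuousAdd X] [Module ℤ_[p] X] (hX : ∀ x : X, Continuous fun a : ℤ_[p] => a • x)
    {s : Set X} (hs : s.Finite) : IsClosed (Submodule.span ℤ_[p] s : Set X) := by
  have := hs.fintype
  rw [← Subtype.range_coe (s := s), ← Fintype.range_linearCombination, LinearMap.coe_range]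
  refine (isCompact_range ?_).isClosed
  change Continuous fun c : s → ℤ_[p] => ∑ i, c i • (i : X)
  exact continuous_finsetSum _ fun i _ => (hX i).comp (continuous_apply i)

/-- Lets the ℤ_p-module structure pass to the completion ℂ_p. -/
instance : UniformContinuousConstSMul ℤ_[p] (PadicAlgCl p) where
  uniformContinuous_const_smul a :=
    (uniformContinuous_const_smul (a : ℚ_[p])).congr fun x => algebraMap_smul ℚ_[p] a x

/-- ℚ_p is the fraction field of ℤ_p, so a ℤ_p-basis stays independent over it. -/
theorem finrank_span_padic {X : Type*} [AddCommGroup X] [Module ℤ_[p] X] [Module ℚ_[p] X]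
    [IsScalarTower ℤ_[p] ℚ_[p] X] (N : Submodule ℤ_[p] X) [Module.Finite ℤ_[p] N] :
    Module.finrank ℤ_[p] N = Module.finrank ℚ_[p] (Submodule.span ℚ_[p] (N : Set X)) := by
  have htf : Module.IsTorsionFree ℤ_[p] X := Module.IsTorsionFree.trans ℚ_[p]
  let b := Module.Free.chooseBasis ℤ_[p] N
  have h1 : LinearIndependent ℤ_[p] fun i => (b i : X) :=
    b.linearIndependent.map' N.subtype N.ker_subtype
  have h2 := (LinearIndependent.iff_fractionRing ℤ_[p] ℚ_[p]).mp h1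
  have h3 : Submodule.span ℚ_[p] (N : Set X) = Submodule.span ℚ_[p] (Set.range fun i => (b i : X)) := by
    refine le_antisymm (Submodule.span_le.mpr fun x hx => ?_) (Submodule.span_mono ?_)
    · have h4 := congrArg N.subtype (b.sum_repr ⟨x, hx⟩)
      simp only [map_sum, map_smul, Submodule.subtype_apply] at h4
      rw [← h4]
      refine Submodule.sum_mem _ fun i _ => ?_
      rw [← algebraMap_smul ℚ_[p] (b.repr ⟨x, hx⟩ i) (b i : X)]
      exact Submodule.smul_mem _ _ (Submodule.subset_span ⟨i, rfl⟩)
    · rintro _ ⟨i, rfl⟩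
      exact (b i).2
  rw [h3, finrank_span_eq_card h2, Module.finrank_eq_card_basis b]

theorem finrank_map_of_ker_torsion {R A B : Type*} [CommRing R] [IsDomain R] [IsNoetherianRing R]
    [AddCommGroup A] [Module R A] [AddCommGroup B] [Module R B] (f : A →ₗ[R] B)
    (hf : ∀ a, f a = 0 → ∃ n : R, n ≠ 0 ∧ n • a = 0) (N : Submodule R A) [Module.Finite R N] :
    Module.finrank R (N.map f) = Module.finrank R N := by
  have h1 := Submodule.finrank_quotient_add_finrank (LinearMap.ker (f.domRestrict N))
  have h0 : Module.finrank R (LinearMap.ker (f.domRestrict N)) = 0 := by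
    rw [Module.finrank_eq_zero_iff]
    rintro ⟨⟨a, ha⟩, haf⟩
    obtain ⟨n, hn, h⟩ := hf a haf
    exact ⟨n, hn, Subtype.ext (Subtype.ext h)⟩
  rw [h0, add_zero, (f.domRestrict N).quotKerEquivRange.finrank_eq, LinearMap.range_domRestrict] at h1
  exact h1

end PadicModules

/-! ### The logarithm on local units -/

section LocalLog

variable {p : ℕ} [Fact p.Prime] {M : Type*} [Field M] [NumberField M]

/-- A continuous extension of `σ` to the completion at the prime which it defines. -/
noncomputable def completionEmbedding (σ : M →+* ℂ_[p]) :
    (embeddingPrime σ).1.adicCompletion M →+* ℂ_[p] :=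
  (factorsThroughCompletion_embeddingPrime σ).choose

theorem continuous_completionEmbedding (σ : M →+* ℂ_[p]) : Continuous (completionEmbedding σ) :=
  (factorsThroughCompletion_embeddingPrime σ).choose_spec.1

theorem completionEmbedding_algebraMap (σ : M →+* ℂ_[p]) (x : M) :
    completionEmbedding σ (algebraMap M ((embeddingPrime σ).1.adicCompletion M) x) = σ x :=
  (RingHom.congr_fun (factorsThroughCompletion_embeddingPrime σ).choose_spec.2 x).symm

theorem norm_completionEmbedding_sub_one_lt (σ : M →+* ℂ_[p])
    (u : LocalUnits (embeddingPrime σ)) :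
    ‖completionEmbedding σ ((u.toMul : ((embeddingPrime σ).1.adicCompletion M)ˣ) :
      (embeddingPrime σ).1.adicCompletion M) - 1‖ < 1 :=
  norm_map_sub_one_lt (continuous_completionEmbedding σ) (norm_coe_sub_one_lt _ u)

/-- The logarithm of the image of a principal local unit in `ℂ_p`. -/
noncomputable def localLogHom (σ : M →+* ℂ_[p]) : LocalUnits (embeddingPrime σ) →+ ℂ_[p] where
  toFun u := padicLog p (completionEmbedding σ
    ((u.toMul : ((embeddingPrime σ).1.adicCompletion M)ˣ) : (embeddingPrime σ).1.adicCompletion M))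
  map_zero' := by simpa using padicLog_one
  map_add' u v := by
    simpa using padicLog_mul (norm_completionEmbedding_sub_one_lt σ u)
      (norm_completionEmbedding_sub_one_lt σ v)

theorem continuous_localLogHom (σ : M →+* ℂ_[p]) : Continuous (localLogHom σ) := by
  rw [continuous_iff_continuousAt]
  intro u
  refine ContinuousAt.comp (f := fun u : LocalUnits (embeddingPrime σ) => completionEmbedding σ
    ((u.toMul : ((embeddingPrime σ).1.adicCompletion M)ˣ) : (embeddingPrime σ).1.adicCompletion M))
    (continuousAt_padicLog (norm_completionEmbedding_sub_one_lt σ u)) ?_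
  exact ((continuous_completionEmbedding σ).comp (isEmbedding_coe _).continuous).continuousAt

theorem padicSMul_complex_eq (a : ℤ_[p]) (x : ℂ_[p]) :
    a • x = algebraMap ℚ_[p] ℂ_[p] (a : ℚ_[p]) * x := by
  rw [← Algebra.smul_def]
  exact (algebraMap_smul ℚ_[p] a x).symm

/-- The logarithm on principal local units is `ℤ_p`-linear. -/
noncomputable def localLog (σ : M →+* ℂ_[p]) : LocalUnits (embeddingPrime σ) →ₗ[ℤ_[p]] ℂ_[p] where
  toFun := localLogHom σ
  map_add' := map_add _
  map_smul' a u := by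
    have h1 := ((continuous_localLogHom σ).tendsto _).comp (tendsto_appr p a u)
    have h2 : Tendsto (fun n => (algebraMap ℚ_[p] ℂ_[p] (((a.appr n : ℤ) : ℤ_[p]) : ℚ_[p])) *
        localLogHom σ u) atTop (𝓝 (algebraMap ℚ_[p] ℂ_[p] (a : ℚ_[p]) * localLogHom σ u)) := by
      refine Tendsto.mul_const _ ?_
      exact ((algebraMapCLM ℚ_[p] ℂ_[p]).continuous.tendsto _).comp
        ((continuous_subtype_val.tendsto a).comp (tendsto_appr_self a))
    rw [RingHom.id_apply, padicSMul_complex_eq]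
    refine tendsto_nhds_unique h1 (h2.congr fun n => ?_)
    simp

theorem exists_zsmul_eq_zero_of_localLog_eq_zero (σ : M →+* ℂ_[p])
    (u : LocalUnits (embeddingPrime σ)) (hu : localLog σ u = 0) : ∃ n : ℕ, n ≠ 0 ∧ n • u = 0 := by
  obtain ⟨n, hn⟩ := exists_pow_prime_pow_eq_one_of_padicLog_eq_zero
    (norm_completionEmbedding_sub_one_lt σ u) hu
  refine ⟨p ^ n, pow_ne_zero _ (Fact.out : p.Prime).ne_zero, ?_⟩
  rw [← map_pow, ← map_one (completionEmbedding σ)] at hn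
  have h := (completionEmbedding σ).injective hn
  apply Additive.toMul.injective
  refine Subtype.ext (Units.ext ?_)
  simpa using h

/-- The embeddings whose prime belongs to `Γ`. -/
def embeddingsOver (Γ : Set (PrimesAbove p M)) : Set (M →+* ℂ_[p]) := {σ | embeddingPrime σ ∈ Γ}

/-- The logarithms of a family of local units under all embeddings over `Γ`. -/
noncomputable def logMap (Γ : Set (PrimesAbove p M)) :
    (∀ v : Γ, LocalUnits v.1) →ₗ[ℤ_[p]] (embeddingsOver Γ → ℂ_[p]) :=
  LinearMap.pi fun σ => localLog σ.1 ∘ₗ LinearMap.proj (⟨embeddingPrime σ.1, σ.2⟩ : Γ)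

theorem logMap_diagonalY (Γ : Set (PrimesAbove p M)) (u : Additive (unitsY Γ))
    (σ : embeddingsOver Γ) :
    logMap Γ (diagonalY Γ u) σ = padicLog p (σ.1 (((u.toMul : (𝓞 M)ˣ) : 𝓞 M) : M)) := by
  rw [← completionEmbedding_algebraMap]
  rfl

/-- Every prime in `Γ` is the prime of some embedding, so a logarithm detects each component up to
torsion. `Γ` is finite, so the annihilators can be multiplied; `σ` is only a base point for the
Galois action. -/
theorem exists_smul_eq_zero_of_logMap_eq_zero [IsGalois ℚ M] (Γ : Set (PrimesAbove p M))
    (σ : M →+* ℂ_[p]) (u : ∀ v : Γ, LocalUnits v.1) (hu : logMap Γ u = 0) :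
    ∃ n : ℤ_[p], n ≠ 0 ∧ n • u = 0 := by
  have h1 : ∀ v : Γ, ∃ n : ℕ, n ≠ 0 ∧ n • u v = 0 := by
    rintro ⟨v, hv⟩
    obtain ⟨g, rfl⟩ := exists_embeddingPrime_eq σ v
    exact exists_zsmul_eq_zero_of_localLog_eq_zero _ _
      (congrFun hu (⟨σ.comp (g : M →+* M), hv⟩ : embeddingsOver Γ))
  choose n hn0 hn using h1
  classical
  have hfin : Finite (PrimesAbove p M) :=
    Finite.of_surjective (fun g : M ≃ₐ[ℚ] M => embeddingPrime (σ.comp (g : M →+* M)))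
      (exists_embeddingPrime_eq σ)
  have := Fintype.ofFinite Γ
  refine ⟨(∏ v, n v : ℕ), Nat.cast_ne_zero.mpr (Finset.prod_ne_zero_iff.mpr fun v _ => hn0 v), ?_⟩
  refine (Nat.cast_smul_eq_nsmul ℤ_[p] (∏ v, n v) u).trans ?_
  funext v
  rw [Pi.smul_apply,
    ← Finset.prod_erase_mul _ _ (Finset.mem_univ v), mul_smul, hn, smul_zero,
    Pi.zero_apply]

end LocalLog

/-! ### The closure of the global units -/

section Closure

variable {p : ℕ} [Fact p.Prime] {M : Type*} [Field M] [NumberField M] (Γ : Set (PrimesAbove p M))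

instance finite_unitsY : Module.Finite ℤ (Additive (unitsY Γ)) :=
  Module.Finite.of_injective (MonoidHom.toAdditive (unitsY Γ).subtype).toIntLinearMap
    fun _ _ h => Additive.toMul.injective (Subtype.ext h)

/-- Finitely many generators of `Y` suffice: the ℤ_p-span of their images is closed and contains the
image of `Y`. -/
theorem exists_finite_closureDiagonalY_eq_span : ∃ s : Set (Additive (unitsY Γ)), s.Finite ∧
    closureDiagonalY Γ = Submodule.span ℤ_[p] (diagonalY Γ '' s) := by
  obtain ⟨s, hs⟩ := (finite_unitsY Γ).fg_top
  refine ⟨s, s.finite_toSet, le_antisymm ?_ (Submodule.span_le.mpr ?_)⟩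
  · have h1 : IsClosed (Submodule.span ℤ_[p] (diagonalY Γ '' s) : Set (∀ v : Γ, LocalUnits v.1)) :=
      isClosed_span_padic p (fun x => continuous_pi fun v => continuous_padicSMul p (x v))
        (s.finite_toSet.image _)
    refine h1.closure_subset_iff.mpr ?_
    rintro _ ⟨u, rfl⟩
    have hu : u ∈ Submodule.span ℤ (s : Set (Additive (unitsY Γ))) := hs ▸ Submodule.mem_top
    induction hu using Submodule.span_induction with
    | mem x hx => exact Submodule.subset_span ⟨x, hx, rfl⟩
    | zero => rw [map_zero]; exact Submodule.zero_mem _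
    | add x y _ _ hx hy => rw [map_add]; exact Submodule.add_mem _ hx hy
    | smul a x _ hx => rw [map_zsmul]; exact zsmul_mem hx a
  · rintro _ ⟨u, -, rfl⟩
    exact subset_closure ⟨u, rfl⟩

instance finite_closureDiagonalY : Module.Finite ℤ_[p] (closureDiagonalY Γ) := by
  obtain ⟨s, hs, h⟩ := exists_finite_closureDiagonalY_eq_span Γ
  rw [h]
  exact Module.Finite.span_of_finite _ (hs.image _)

theorem closureDiagonalY_eq_span :
    closureDiagonalY Γ = Submodule.span ℤ_[p] (Set.range (diagonalY Γ)) := by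
  obtain ⟨s, hs, h⟩ := exists_finite_closureDiagonalY_eq_span Γ
  refine le_antisymm ?_ (Submodule.span_le.mpr subset_closure)
  rw [h]
  exact Submodule.span_mono (Set.image_subset_range _ _)

/-- The vector of logarithms of a unit under the embeddings over `Γ`. -/
noncomputable def logVector (u : (𝓞 M)ˣ) (σ : embeddingsOver Γ) : ℂ_[p] :=
  padicLog p (σ.1 ((u : 𝓞 M) : M))

theorem finrank_closureDiagonalY_eq [IsGalois ℚ M] (σ : M →+* ℂ_[p]) :
    Module.finrank ℤ_[p] (closureDiagonalY Γ) =
      Module.finrank ℚ_[p] (Submodule.span ℚ_[p] (logVector Γ '' (unitsY Γ : Set (𝓞 M)ˣ))) := by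
  rw [← finrank_map_of_ker_torsion (logMap Γ) (exists_smul_eq_zero_of_logMap_eq_zero Γ σ),
    finrank_span_padic]
  have h : logMap Γ '' Set.range (diagonalY Γ) = logVector Γ '' (unitsY Γ : Set (𝓞 M)ˣ) := by
    ext w
    constructor
    · rintro ⟨_, ⟨u, rfl⟩, rfl⟩
      exact ⟨u.toMul, u.toMul.2, funext fun σ => (logMap_diagonalY Γ u σ).symm⟩
    · rintro ⟨u, hu, rfl⟩
      exact ⟨_, ⟨Additive.ofMul ⟨u, hu⟩, rfl⟩, funext fun σ => logMap_diagonalY Γ _ σ⟩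
  rw [closureDiagonalY_eq_span, Submodule.map_span, h, Submodule.span_span_of_tower]

theorem discUnits_le_unitsY [IsGalois ℚ M] (σ : M →+* ℂ_[p]) : discUnits p M ≤ unitsY Γ := by
  intro u hu v _
  obtain ⟨g, hg⟩ := exists_embeddingPrime_eq σ v.1
  refine (mem_principalUnits_iff v.1 _).mpr ?_
  have h1 : (u : 𝓞 M) - 1 ∈ v.1.1.asIdeal := by
    rw [← hg]
    change ‖(σ.comp (g : M →+* M)) (((u : 𝓞 M) : M) - 1)‖ < 1
    rw [map_sub, map_one]
    exact hu _
  have h2 := (FinitePlace.norm_lt_one_iff_mem M v.1.1 ((u : 𝓞 M) - 1)).mpr h1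
  rw [map_sub, map_one, map_sub, map_one] at h2
  exact h2

end Closure

/-! ### The rank of the closure of the global units -/

section ClosureRank

variable {p : ℕ} [Fact p.Prime] {M : Type*} [Field M] [NumberField M] (Γ : Set (PrimesAbove p M))

/-- The vector of logarithms as a homomorphism on `Y`. -/
noncomputable def logVectorHom : Additive (unitsY Γ) →+ (embeddingsOver Γ → ℂ_[p]) :=
  (logMap Γ).toAddMonoidHom.comp (diagonalY Γ)

theorem logVectorHom_apply (u : Additive (unitsY Γ)) :
    logVectorHom Γ u = logVector Γ (u.toMul : (𝓞 M)ˣ) :=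
  funext fun σ => logMap_diagonalY Γ u σ

/-- There are elements of `𝓞 M` which are close to `1` at a prescribed set of primes above `p` and
close to `0` at the others. -/
theorem exists_near_one_near_zero (P : Ideal (𝓞 M) → Prop) : ∃ e : 𝓞 M,
    ∀ σ : M →+* ℂ_[p], (P (embeddingIdeal σ) → ‖σ (e : M) - 1‖ < 1) ∧
      (¬P (embeddingIdeal σ) → ‖σ (e : M)‖ < 1) := by
  classical
  let s : Finset (Ideal (𝓞 M)) := Finset.univ.image fun σ : M →+* ℂ_[p] => embeddingIdeal σ
  obtain ⟨e, he⟩ := IsDedekindDomain.exists_forall_sub_mem_ideal (s := s) (fun I => I) (fun _ => 1)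
    (fun I hI => by
      obtain ⟨σ, -, rfl⟩ := Finset.mem_image.mp hI
      exact Ideal.prime_of_isPrime (embeddingPrime σ).1.ne_bot (isPrime_embeddingIdeal σ))
    (fun _ _ _ _ h => h) (fun I => if P I.1 then 1 else 0)
  refine ⟨e, fun σ => ?_⟩
  have h := he (embeddingIdeal σ) (Finset.mem_image_of_mem _ (Finset.mem_univ σ))
  rw [pow_one] at h
  constructor
  · intro hP
    rw [if_pos hP] at h
    have h1 : ‖σ ((e : M) - 1)‖ < 1 := h
    rwa [map_sub, map_one] at h1
  · intro hP
    rw [if_neg hP, sub_zero] at h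
    exact h

variable [NumberField.IsCMField M] {c : M ≃ₐ[ℚ] M}

/-- The restrictions to the maximal real subfield of the embeddings over `Γ`. -/
def realEmbeddingsOver : Set (maximalRealSubfield M →+* ℂ_[p]) :=
  (fun σ : M →+* ℂ_[p] => σ.comp (algebraMap (maximalRealSubfield M) M)) '' embeddingsOver Γ

theorem comp_conj_restrict (hc : IsInducedByConj c) (σ : M →+* ℂ_[p]) :
    (σ.comp (c : M →+* M)).comp (algebraMap (maximalRealSubfield M) M) =
      σ.comp (algebraMap (maximalRealSubfield M) M) := by
  ext x
  change σ (c (x : M)) = σ (x : M)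
  rw [hc.apply_eq, IsCMField.complexConj_apply_eq_self]

theorem exists_comp_algebraMap_eq (τ : maximalRealSubfield M →+* ℂ_[p]) :
    ∃ σ : M →+* ℂ_[p], σ.comp (algebraMap (maximalRealSubfield M) M) = τ := by
  let := τ.toAlgebra
  let f : M →ₐ[maximalRealSubfield M] ℂ_[p] := IsAlgClosed.lift
  exact ⟨f.toRingHom, RingHom.ext fun x => f.commutes x⟩

variable [IsGalois ℚ M]

/-- The r conjugates have finite index modulo torsion, so a nonzero multiple of the class of `u` is
an integral combination of theirs; the logarithms divide the multiple out. -/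
theorem logVector_mem_span (hc : IsInducedByConj c) {ε : (𝓞 M)ˣ}
    (h : HasIndependentConjugates c ε) (hε : ε ∈ discUnits p M) (σ : M →+* ℂ_[p])
    {u : (𝓞 M)ˣ} (hu : u ∈ unitsY Γ) :
    logVector Γ u ∈ Submodule.span ℚ_[p] (Set.range
      fun x : {x : (M ≃ₐ[ℚ] M) ⧸ Subgroup.zpowers c // x ≠ (1 : M ≃ₐ[ℚ] M)} =>
        logVector Γ (galUnit x.1.out ε)) := by
  classical
  have hF := Fintype.ofFinite
    {x : (M ≃ₐ[ℚ] M) ⧸ Subgroup.zpowers c // x ≠ (1 : M ≃ₐ[ℚ] M)}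
  obtain ⟨n, hn, h1⟩ := exists_smul_mem_span_of_card_eq_finrank
    (by rw [finrank_unitClass, ← card_ne_one hc, Nat.card_eq_fintype_card]) h
    (unitClass (Additive.ofMul u))
  obtain ⟨m, hm⟩ := (Submodule.mem_span_range_iff_exists_fun ℤ).mp h1
  let U : Additive (unitsY Γ) := Additive.ofMul ⟨u, hu⟩
  let E : {x : (M ≃ₐ[ℚ] M) ⧸ Subgroup.zpowers c // x ≠ (1 : M ≃ₐ[ℚ] M)} → Additive (unitsY Γ) :=
    fun x => Additive.ofMul
      ⟨galUnit x.1.out ε, discUnits_le_unitsY Γ σ (galUnit_mem_discUnits hε x.1.out)⟩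
  let f : Additive (unitsY Γ) →+ Additive (𝓞 M)ˣ := MonoidHom.toAdditive (unitsY Γ).subtype
  have h2 : unitClass (f (n • U - ∑ x, m x • E x)) = 0 := by
    rw [map_sub, map_zsmul, map_sum, map_sub, map_zsmul, map_sum, sub_eq_zero]
    refine Eq.trans hm.symm (Finset.sum_congr rfl fun x _ => ?_)
    rw [map_zsmul, map_zsmul]
    rfl
  obtain ⟨k, hk, h3⟩ := exists_zsmul_eq_zero_of_unitClass_eq_zero _ h2
  rw [← map_zsmul] at h3
  have h4 : k • (n • U - ∑ x, m x • E x) = 0 := Additive.toMul.injective (Subtype.ext h3)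
  have h5 := congrArg (logVectorHom Γ) h4
  rw [map_zsmul, map_zero, smul_eq_zero, or_iff_right hk, map_sub, sub_eq_zero, map_zsmul,
    map_sum] at h5
  have h6 : (n : ℚ_[p]) • logVector Γ u ∈ Submodule.span ℚ_[p] (Set.range
      fun x : {x : (M ≃ₐ[ℚ] M) ⧸ Subgroup.zpowers c // x ≠ (1 : M ≃ₐ[ℚ] M)} =>
        logVector Γ (galUnit x.1.out ε)) := by
    rw [Int.cast_smul_eq_zsmul]
    rw [logVectorHom_apply] at h5
    have h7 : n • logVector Γ u = _ := h5
    rw [h7]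
    refine Submodule.sum_mem _ fun x _ => ?_
    rw [map_zsmul, logVectorHom_apply]
    exact zsmul_mem (Submodule.subset_span (Set.mem_range_self x)) _
  exact (Submodule.smul_mem_iff _ (Int.cast_ne_zero.mpr hn)).mp h6

/-- The restriction of σg to the real subfield depends only on the class of `g`. -/
theorem ncard_realEmbeddingsOver_le (hc : IsInducedByConj c) (σ : M →+* ℂ_[p]) :
    (realEmbeddingsOver Γ).ncard ≤ (rowClasses c (embeddingsOver Γ) σ).ncard := by
  refine (Set.ncard_le_ncard ?_).trans (Set.ncard_image_le
    (f := fun x : (M ≃ₐ[ℚ] M) ⧸ Subgroup.zpowers c =>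
      (σ.comp (x.out : M →+* M)).comp (algebraMap (maximalRealSubfield M) M)))
  rintro _ ⟨τ, hτ, rfl⟩
  obtain ⟨g, rfl⟩ := exists_eq_comp σ τ
  refine ⟨g, ⟨g, fun h => h hτ, rfl⟩, ?_⟩
  refine apply_out_mk hc.central hc.mul_self
    (f := fun g : M ≃ₐ[ℚ] M => (σ.comp (g : M →+* M)).comp (algebraMap (maximalRealSubfield M) M))
    (fun g => ?_) g
  rw [hc.central]
  exact comp_conj_restrict hc (σ.comp (g : M →+* M))

/-- `Γ` need not be stable under `c`, so `e` is chosen near 1 at the primes of all σ with σ or σc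
over `Γ`. This symmetric condition lets the real element e·c(e) inherit both estimates. -/
theorem exists_near_realEmbeddingsOver (hc : IsInducedByConj c) : ∃ e : maximalRealSubfield M,
    (∀ τ ∈ realEmbeddingsOver Γ, ‖τ e - 1‖ < 1) ∧ ∀ τ ∉ realEmbeddingsOver Γ, ‖τ e‖ < 1 := by
  obtain ⟨e, he⟩ := exists_near_one_near_zero (p := p) (M := M) fun I =>
    ∃ σ : M →+* ℂ_[p], embeddingIdeal σ = I ∧
      (σ ∈ embeddingsOver Γ ∨ σ.comp (c : M →+* M) ∈ embeddingsOver Γ)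
  have hcc : ∀ x, c (c x) = x := fun x => AlgEquiv.congr_fun hc.mul_self x
  have hcomp : ∀ σ : M →+* ℂ_[p], (σ.comp (c : M →+* M)).comp (c : M →+* M) = σ := fun σ =>
    RingHom.ext fun x => congrArg σ (hcc x)
  have h1 : ∀ σ : M →+* ℂ_[p],
      (σ ∈ embeddingsOver Γ ∨ σ.comp (c : M →+* M) ∈ embeddingsOver Γ) → ‖σ (e : M) - 1‖ < 1 :=
    fun σ hσ => (he σ).1 ⟨σ, rfl, hσ⟩
  have h0 : ∀ σ : M →+* ℂ_[p],
      ¬(σ ∈ embeddingsOver Γ ∨ σ.comp (c : M →+* M) ∈ embeddingsOver Γ) → ‖σ (e : M)‖ < 1 := by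
    refine fun σ hσ => (he σ).2 ?_
    rintro ⟨τ, hτ, h⟩
    refine hσ (h.imp (fun h => ?_) fun h => ?_)
    · have : embeddingPrime σ = embeddingPrime τ := primesAbove_ext hτ.symm
      exact Set.mem_ofPred_eq .. ▸ this ▸ h
    · have : embeddingPrime (σ.comp (c : M →+* M)) = embeddingPrime (τ.comp (c : M →+* M)) :=
        primesAbove_ext (congrArg
          (Ideal.comap (RingOfIntegers.mapRingHom (c : M →+* M))) hτ).symm
      exact Set.mem_ofPred_eq .. ▸ this ▸ h
  have hfix : (e : M) * c (e : M) ∈ maximalRealSubfield M := by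
    rw [← IsCMField.complexConj_eq_self_iff, ← hc.apply_eq, map_mul, hcc, mul_comm]
  refine ⟨⟨_, hfix⟩, ?_, fun τ hτ => ?_⟩
  · rintro _ ⟨σ, hσ, rfl⟩
    change ‖σ ((e : M) * c (e : M)) - 1‖ < 1
    rw [map_mul]
    exact norm_mul_sub_one_lt (h1 σ (Or.inl hσ))
      (h1 (σ.comp (c : M →+* M)) (Or.inr ((hcomp σ).symm ▸ hσ)))
  · obtain ⟨σ, rfl⟩ := exists_comp_algebraMap_eq τ
    have h2 : σ ∉ embeddingsOver Γ := fun h => hτ ⟨σ, h, rfl⟩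
    have h3 : σ.comp (c : M →+* M) ∉ embeddingsOver Γ := fun h =>
      hτ ⟨_, h, comp_conj_restrict hc σ⟩
    change ‖σ ((e : M) * c (e : M))‖ < 1
    rw [map_mul, norm_mul]
    refine mul_lt_one_of_nonneg_of_lt_one_left (norm_nonneg _) (h0 σ (not_or.mpr ⟨h2, h3⟩)) ?_
    exact (h0 (σ.comp (c : M →+* M)) (not_or.mpr ⟨h3, (hcomp σ).symm ▸ h2⟩)).le

/-- Since `u` and c(u) have equal logarithms, log u = ½ log(u·c(u)), and u·c(u) lies in the real
subfield. -/
theorem logVector_mem_map (hc : IsInducedByConj c) {u : (𝓞 M)ˣ} (hu : u ∈ discUnits p M) :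
    logVector Γ u ∈ (((embeddingSpan p (maximalRealSubfield M)).map
      (restrictLinear ℚ_[p] ℂ_[p] (realEmbeddingsOver Γ))).map
      (LinearMap.funLeft ℚ_[p] ℂ_[p] fun σ : embeddingsOver Γ =>
        (⟨_, ⟨σ.1, σ.2, rfl⟩⟩ : realEmbeddingsOver Γ))) := by
  have hfix : ((u : 𝓞 M) : M) * c ((u : 𝓞 M) : M) ∈ maximalRealSubfield M := by
    rw [← IsCMField.complexConj_eq_self_iff, ← hc.apply_eq, map_mul,
      show c (c ((u : 𝓞 M) : M)) = _ from AlgEquiv.congr_fun hc.mul_self _, mul_comm]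
    rfl
  have hcu := galUnit_mem_discUnits hu c
  have h1 : ∀ τ : maximalRealSubfield M →+* ℂ_[p], ‖τ ⟨_, hfix⟩ - 1‖ < 1 := by
    intro τ
    obtain ⟨σ, rfl⟩ := exists_comp_algebraMap_eq τ
    change ‖σ (((u : 𝓞 M) : M) * c ((u : 𝓞 M) : M)) - 1‖ < 1
    rw [map_mul]
    exact norm_mul_sub_one_lt (hu σ) (hcu σ)
  have h2 := padicLog_mem_embeddingSpan h1
  have h3 : logVector Γ u = (2⁻¹ : ℚ_[p]) • fun σ : embeddingsOver Γ =>
      padicLog p (σ.1 (((u : 𝓞 M) : M) * c ((u : 𝓞 M) : M))) := by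
    ext σ
    have h4 : padicLog p (σ.1 (c ((u : 𝓞 M) : M))) = padicLog p (σ.1 ((u : 𝓞 M) : M)) :=
      logHom_eq_of_unitClass_eq σ.1 hcu hu (unitClass_galUnit_conj hc u)
    have h5 : padicLog p (σ.1 ((u : 𝓞 M) : M) * σ.1 (c ((u : 𝓞 M) : M))) =
        padicLog p (σ.1 ((u : 𝓞 M) : M)) + padicLog p (σ.1 (c ((u : 𝓞 M) : M))) :=
      padicLog_mul (hu σ.1) (hcu σ.1)
    rw [Pi.smul_apply, map_mul, h5, h4, ← two_nsmul,
      ← Nat.cast_smul_eq_nsmul ℚ_[p], smul_smul]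
    simp [logVector]
  rw [h3]
  exact Submodule.smul_mem _ _ ⟨_, ⟨_, h2, rfl⟩, rfl⟩

theorem finrank_closureDiagonalY (hSp : PadicSchanuelConjecture p) (hc : IsInducedByConj c)
    (σ : M →+* ℂ_[p]) :
    Module.finrank ℤ_[p] (closureDiagonalY Γ) =
      min (rowClasses c (embeddingsOver Γ) σ).ncard (Units.rank M) := by
  classical
  obtain ⟨ε₀, hε₀⟩ := exists_hasIndependentConjugates hc
  obtain ⟨n, hn, hdisc⟩ := exists_pow_mem_discUnits (p := p) (M := M)
  set ε := ε₀ ^ n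
  have h : HasIndependentConjugates c ε := hε₀.pow hn
  have hε : ε ∈ discUnits p M := hdisc ε₀
  rw [finrank_closureDiagonalY_eq Γ σ]
  set W := Submodule.span ℚ_[p] (logVector Γ '' (unitsY Γ : Set (𝓞 M)ˣ))
  have hW : W ≤ Submodule.span ℚ_[p] (Set.range
      fun x : {x : (M ≃ₐ[ℚ] M) ⧸ Subgroup.zpowers c // x ≠ (1 : M ≃ₐ[ℚ] M)} =>
        logVector Γ (galUnit x.1.out ε)) := by
    refine Submodule.span_le.mpr ?_
    rintro _ ⟨u, hu, rfl⟩
    exact logVector_mem_span Γ hc h hε σ hu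
  have hfin := FiniteDimensional.span_of_finite ℚ_[p] (Set.finite_range
      fun x : {x : (M ≃ₐ[ℚ] M) ⧸ Subgroup.zpowers c // x ≠ (1 : M ≃ₐ[ℚ] M)} =>
        logVector Γ (galUnit x.1.out ε))
  have hfinW : FiniteDimensional ℚ_[p] W := Submodule.finiteDimensional_of_le hW
  refine le_antisymm (le_min ?_ ?_) ?_
  -- Bound by the number of classes, through the real subfield.
  · refine le_trans ?_ (ncard_realEmbeddingsOver_le Γ hc σ)
    obtain ⟨e, he1, he0⟩ := exists_near_realEmbeddingsOver Γ hc
    refine le_trans ?_ (finrank_restrict_embeddingSpan_le he1 he0)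
    refine le_trans ?_ (Submodule.finrank_map_le
      (LinearMap.funLeft ℚ_[p] ℂ_[p] fun σ : embeddingsOver Γ =>
        (⟨_, ⟨σ.1, σ.2, rfl⟩⟩ : realEmbeddingsOver Γ)) _)
    refine Submodule.finrank_mono (hW.trans (Submodule.span_le.mpr ?_))
    rintro _ ⟨x, rfl⟩
    exact logVector_mem_map Γ hc (galUnit_mem_discUnits hε _)
  · have hF := Fintype.ofFinite
      {x : (M ≃ₐ[ℚ] M) ⧸ Subgroup.zpowers c // x ≠ (1 : M ≃ₐ[ℚ] M)}
    refine (Submodule.finrank_mono hW).trans ((finrank_range_le_card _).trans ?_)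
    rw [← Nat.card_eq_fintype_card, card_ne_one hc]
  -- The columns of the matrix are logarithm vectors of units in `Y`, so its ℂ_p-rank is at most the
  -- ℚ_p-dimension of `W`.
  · rw [← rank_padicLogMatrix_eq_min hSp hc h hε, Matrix.rank_eq_finrank_span_cols]
    refine le_trans (Submodule.finrank_mono ?_) (finrank_span_le_finrank (F := ℂ_[p]) W)
    refine Submodule.span_mono ?_
    rintro _ ⟨g, rfl⟩
    exact Submodule.subset_span
      ⟨galUnit g ε, discUnits_le_unitsY Γ σ (galUnit_mem_discUnits hε g), rfl⟩

end ClosureRank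

end SomeUnits

theorem mainTheorem5 (p : ℕ) [Fact p.Prime] (M : Type*) [Field M] [NumberField M] [IsGalois ℚ M]
    [NumberField.IsCMField M]
    (hS : SomeUnits.SchanuelConjecture) (hSp : SomeUnits.PadicSchanuelConjecture p) :
    (∃! c : M ≃ₐ[ℚ] M, SomeUnits.IsInducedByConj c) ∧
    ∀ c : M ≃ₐ[ℚ] M, SomeUnits.IsInducedByConj c →
      -- the rank of the matrix of logarithms, for an arbitrary set `S` of embeddings
      (∀ ε : (𝓞 M)ˣ, SomeUnits.IsWeakMinkowskiUnit ε →
        (∀ (σ : M →+* ℂ_[p]) (g : M ≃ₐ[ℚ] M), ‖σ (g ((ε : 𝓞 M) : M)) - 1‖ < 1) →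
        ∀ (S : Set (M →+* ℂ_[p])) (σ : M →+* ℂ_[p]),
          ((SomeUnits.padicLogMatrix S ε).rank : ℤ) =
            (Module.finrank ℤ (Additive (𝓞 M)ˣ) : ℤ) -
              max ((SomeUnits.cosetCount c (SomeUnits.complementJ S σ) : ℤ) - 1) 0) ∧
      -- the rank of the closure of the image of `Y`, for an arbitrary set `Γ` of primes above `p`
      (∀ (Γ : Set (SomeUnits.PrimesAbove p M)), ∀ v₀ ∈ Γ, ∀ σ₀ : M →+* ℂ_[p],
        SomeUnits.FactorsThroughCompletion v₀ σ₀ → ∀ σ : M →+* ℂ_[p],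
          Module.Finite ℤ_[p] (SomeUnits.closureDiagonalY Γ) ∧
          (Module.finrank ℤ_[p] (SomeUnits.closureDiagonalY Γ) : ℤ) =
            (Module.finrank ℤ (Additive (𝓞 M)ˣ) : ℤ) -
              max ((SomeUnits.cosetCount c
                (SomeUnits.complementJ (SomeUnits.rowSet Γ v₀ σ₀) σ) : ℤ) - 1) 0) := by
  refine ⟨SomeUnits.existsUnique_isInducedByConj, fun c hc =>
    ⟨fun ε hε hdisc S σ => ?_, fun Γ v₀ hv₀ σ₀ hσ₀ σ => ⟨inferInstance, ?_⟩⟩⟩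
  · have hd : ε ∈ SomeUnits.discUnits p M := fun σ => hdisc σ 1
    rw [SomeUnits.rank_padicLogMatrix_eq_min hSp hc (hε.hasIndependentConjugates hc) hd S σ]
    exact SomeUnits.min_ncard_rowClasses hc S σ
  · have h : SomeUnits.rowSet Γ v₀ σ₀ = SomeUnits.embeddingsOver Γ :=
      Set.ext (SomeUnits.mem_rowSet_iff hσ₀)
    rw [h, SomeUnits.finrank_closureDiagonalY Γ hSp hc σ]
    exact SomeUnits.min_ncard_rowClasses hc _ σ
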